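/- Let $\mathcal A$ be a finite von Neumann algebra with a faithful normal finite trace $\tau$, acting by left multiplication on $\mathcal H=L^2(\mathcal A,\tau)$; regard $\mathcal A\subset\mathcal H$, and write $\|a\|_2=\tau(a^*a)^{1/2}$ for the norm of $\mathcal H$ and $\|a\|_\infty$ for the norm of $\mathcal A$. Let $I\subset\mathbb R$ be an interval with $0\in I$, and for $t\in I$ let $\mathcal B_t\subset\mathcal A$ be a (unital) von Neumann subalgebra and $E_t:\mathcal A\to\mathcal B_t$ the $\tau$-preserving conditional expectation. Assume: (a) for all $a\in\mathcal A$, $\xi\in\mathcal H$ the map $I\ni t\mapsto E_t(a)\xi\in\mathcal H$ is continuously differentiable; put $dE_t(a)\xi=\frac{d}{dt}E_t(a)\xi$; (b) for every closed bounded interval $J\subset I$ there is a constant $C_J$ such that $\int_J\|dE_t(a)\|_2^2\,dt\le C_J\|a\|_2^2$ for all $a\in\mathcal A$, where $\|dE_t(a)\|_2$ is the norm in $\mathcal H$ of $dE_t(a)1$. (Derivatives at end points of $I$ are one-sided.) Then $dE_t(a)\in\mathcal A$ for all $t\in I$, $a\in\mathcal A$, and for all $s\in I$, $a\in\mathcal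 A$ the transport equation $$\dot\alpha(t)=dE_t(E_t(\alpha(t)))-E_t(dE_t(\alpha(t))),\qquad \alpha(s)=a,$$ has exactly one weak solution $\alpha:I\to\mathcal A$, i.e. such that $\frac{d}{dt}\langle\alpha(t),\xi\rangle=\langle dE_t(E_t(\alpha(t)))-E_t(dE_t(\alpha(t))),\xi\rangle$ for all $t\in I$, $\xi\in\mathcal H$; this solution is $\|\cdot\|_\infty$-bounded on closed bounded subintervals of $I$, and $t\mapsto\langle\alpha(t),\xi\rangle$ is $C^1$ on $I$ for every $\xi\in\mathcal H$. Let $G_{t,s}(a)=\alpha(t)$ be the propagator and $G_t=G_{t,0}$. Then, for $t\in I$: 1. $G_t:\mathcal A\to\mathcal A$ is a linear bijection with inverse $G_{0,t}$, the curve $t\mapsto\langle G_t(a),\xi\rangle$ is $C^1$ on $I$ for all $a\in\mathcal A$, $\xi\in\mathcal H$, and $G_0=\mathrm{Id}$; 2. $G_t$ is unital and $*$-preserving; 3. $G_tE_0G_t^{-1}=E_t$; 4. $\|G_t(a)\|_2=\|a\|_2$ for all $a\in\mathcal A$, so $G_t$ extends to a unitary operator $U_t$ on $\mathcal H$; the map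 $E_t$ extends to an orthogonal projection $e_t$ on $\mathcal H$, and $U_te_0U_t^*=e_t$. -/

import Mathlib

open Set MeasureTheory
open scoped InnerProductSpace ComplexOrder

namespace SmoothExpectations

section

variable {A : Type*} [CStarAlgebra A] [PartialOrder A] [StarOrderedRing A]

/-- A faithful finite trace: a positive linear functional on `A` which is tracial and faithful.
Here `τ.GNS` is the Hilbert space `L²(A, τ)`, the completion of `A` for
`⟪a, b⟫ = τ (a* b)`, and `τ.gnsStarAlgHom` is the action of `A` on it by left multiplication. -/
structure IsFaithfulTrace (τ : A →ₚ[ℂ] ℂ) : Prop where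
  tracial : ∀ a b : A, τ (a * b) = τ (b * a)
  faithful : ∀ a : A, τ (star a * a) = 0 → a = 0

/-- The unital `*`-subalgebra `S ⊆ A`, acting on `L²(A, τ)` by left multiplication, is a von Neumann
algebra of operators on `L²(A, τ)`. For `S = ⊤` and `τ` a faithful trace this says that `A` is a
finite von Neumann algebra in its standard representation; `τ` is then automatically normal, being
the vector functional of the class of `1`. -/
def IsVonNeumannOnL2 (τ : A →ₚ[ℂ] ℂ) (S : StarSubalgebra ℂ A) : Prop :=
  ∃ M : VonNeumannAlgebra τ.GNS,
    (M : Set (τ.GNS →L[ℂ] τ.GNS)) = τ.gnsStarAlgHom '' (S : Set A)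

/-- The inclusion `A ⊆ L²(A, τ)`. -/
noncomputable def toL2 (τ : A →ₚ[ℂ] ℂ) (a : A) : τ.GNS :=
  ((τ.toPreGNS a : τ.PreGNS) : τ.GNS)

/-- `E : A → B ⊆ A` is a trace preserving conditional expectation onto `B`. -/
structure IsTraceCondExp (τ : A →ₚ[ℂ] ℂ) (B : StarSubalgebra ℂ A) (E : A →ₗ[ℂ] A) : Prop where
  mem : ∀ a, E a ∈ B
  map_of_mem : ∀ b ∈ B, E b = b
  nonneg : ∀ a, 0 ≤ a → 0 ≤ E a
  bimodule : ∀ b ∈ B, ∀ c ∈ B, ∀ a, E (b * a * c) = b * E a * c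
  trace : ∀ a, τ (E a) = τ a

/-- The path `t ↦ E t` is smooth on `I`: `t ↦ E_t(a) ξ` is `C¹` for all `a ∈ A`, `ξ ∈ L²(A, τ)`. -/
def IsSmoothPath (τ : A →ₚ[ℂ] ℂ) (E : ℝ → A →ₗ[ℂ] A) (I : Set ℝ) : Prop :=
  ∀ (a : A) (ξ : τ.GNS), ContDiffOn ℝ 1 (fun t => τ.gnsStarAlgHom (E t a) ξ) I

/-- The derivative operator on `L²(A, τ)`: `dE_t(a) ξ = d/dt E_t(a) ξ` (one-sided at end points
of `I`). -/
noncomputable def derivOp (τ : A →ₚ[ℂ] ℂ) (E : ℝ → A →ₗ[ℂ] A) (I : Set ℝ) (t : ℝ) (a : A)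
    (ξ : τ.GNS) : τ.GNS :=
  derivWithin (fun s => τ.gnsStarAlgHom (E s a) ξ) I t

open Classical in
/-- `dE_t(a)` as an element of `A`: the element of `A` which acts on `L²(A, τ)` as `derivOp`
(unique when `τ` is faithful). -/
noncomputable def dE (τ : A →ₚ[ℂ] ℂ) (E : ℝ → A →ₗ[ℂ] A) (I : Set ℝ) (t : ℝ) (a : A) : A :=
  if h : ∃ x : A, ∀ ξ : τ.GNS, τ.gnsStarAlgHom x ξ = derivOp τ E I t a ξ then h.choose else 0

/-- For every closed bounded `[c, d] ⊆ I` there is a constant `C` with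
`∫_c^d ‖dE_t(a)‖₂² dt ≤ C ‖a‖₂²` for all `a ∈ A`; here `‖dE_t(a)‖₂` is the norm of `dE_t(a) 1`. -/
def SquareIntegrableDeriv (τ : A →ₚ[ℂ] ℂ) (E : ℝ → A →ₗ[ℂ] A) (I : Set ℝ) : Prop :=
  ∀ c d : ℝ, c ≤ d → Icc c d ⊆ I → ∃ C : ℝ, ∀ a : A,
    ∫ t in c..d, ‖derivOp τ E I t a (toL2 τ 1)‖ ^ 2 ≤ C * ‖toL2 τ a‖ ^ 2

/-- The generator `[dE_t, E_t] : A → A` of the transport equation. -/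
noncomputable def transportGen (τ : A →ₚ[ℂ] ℂ) (E : ℝ → A →ₗ[ℂ] A) (I : Set ℝ) (t : ℝ) (a : A) :
    A :=
  dE τ E I t (E t a) - E t (dE τ E I t a)

/-- `α : I → A` is a weak solution of `α' = [dE_t, E_t] α`, `α(s) = a`. -/
def IsTransportSolution (τ : A →ₚ[ℂ] ℂ) (E : ℝ → A →ₗ[ℂ] A) (I : Set ℝ) (s : ℝ) (a : A)
    (α : ℝ → A) : Prop :=
  α s = a ∧ ∀ ξ : τ.GNS, ∀ t ∈ I,
    HasDerivWithinAt (fun u => ⟪ξ, toL2 τ (α u)⟫_ℂ)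
      ⟪ξ, toL2 τ (transportGen τ E I t (α t))⟫_ℂ I t

open Classical in
/-- The propagator `G_{t,s}(a) = α(t)`, where `α` is the weak solution of the transport equation
with `α(s) = a`. -/
noncomputable def propagator (τ : A →ₚ[ℂ] ℂ) (E : ℝ → A →ₗ[ℂ] A) (I : Set ℝ) (t s : ℝ) (a : A) :
    A :=
  if h : ∃ α : ℝ → A, IsTransportSolution τ E I s a α then h.choose t else 0

/-- The bounded operator `T` on `L²(A, τ)` extends the map `F : A → A`. -/
def ExtendsToL2 (τ : A →ₚ[ℂ] ℂ) (F : A → A) (T : τ.GNS →L[ℂ] τ.GNS) : Prop :=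
  ∀ a : A, T (toL2 τ a) = toL2 τ (F a)

end

end SmoothExpectations

/-!
The transport equation `α' = [dE_t, E_t] α` is solved in the Hilbert space `L²(A, τ)`, where its
generator is skew-adjoint, and the solution is then shown not to leave `A`.

*The derivative.* `dE_t(a)` is a strong limit of elements of `A`, so it is a bounded operator that
commutes with the commutant of `A`, hence an element of `A` (`gns_dE`). For the inner product of
`L²(A, τ)` the map `dE_t` is symmetric. By the closed graph theorem it is bounded for the norm of
`A`, and by the uniform boundedness principle it is so uniformly on compact subintervals of `I`
(`exists_norm_dE_le`). A symmetric operator which is bounded for the norm of `A` is bounded for the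
`L²` norm with the same constant (`norm_toL2_apply_le_of_symmetric`, an argument of Krein). So the
generator extends to a strongly continuous, locally bounded family of skew-adjoint operators
(`exists_generator`).

*Existence.* The Dyson series solves such an equation on all of `I`
(`exists_linear_ode_solution`). The same factorial bound holds for its terms when the norm of the
Hilbert space is replaced by the gauge of a set of functionals which grows by a bounded factor under
the generator. This is applied to the polar of the unit ball of `A`: that ball is closed in
`L²(A, τ)` because `τ` is a trace and `A` is strongly closed (`isClosed_image_unitBall`), so by the
bipolar theorem vectors of finite gauge belong to `A` (`exists_toL2_eq_of_polar`).

*Uniqueness.* A weak solution has constant inner product with every strong solution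
(`inner_eq_of_weak_solution`), in particular with the one that passes through its value at a given
time. This determines it (`eq_zero_of_weak_solution`), and it also shows that the propagators are
isometric.

*The propagators.* By uniqueness, each algebraic property of the propagators follows by exhibiting a
solution. For the intertwining relation this is `E_t (α t)`, and the identity needed is
`[[dE_t, E_t], E_t] = dE_t` (`transportGen_condExp`), a consequence of the derivative
`dE_t E_t + E_t dE_t = dE_t` of `E_t² = E_t`.
-/

namespace SmoothExpectations

/-! ### Linear equations with a strongly continuous generator -/

section LinearODE

open Filter Topology

variable {H : Type*} [NormedAddCommGroup H] [NormedSpace ℝ H]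

/-- Two points of an interval `I` lie in a common compact subinterval, which can be chosen to be a
neighbourhood of the second point within `I`. -/
lemma exists_Icc_mem_nhdsWithin {I : Set ℝ} (hI : I.OrdConnected) {s t : ℝ} (hs : s ∈ I)
    (ht : t ∈ I) :
    ∃ c d : ℝ, s ∈ Icc c d ∧ t ∈ Icc c d ∧ Icc c d ⊆ I ∧ Icc c d ∈ 𝓝[I] t := by
  obtain ⟨c, hcI, hcs, hct, hc⟩ : ∃ c ∈ I, c ≤ s ∧ c ≤ t ∧ Ici c ∈ 𝓝[I] t := by
    by_cases h : ∃ c ∈ I, c < t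
    · obtain ⟨c, hc, hct⟩ := h
      refine ⟨min c s, ?_, min_le_right _ _, (min_le_left _ _).trans hct.le,
        mem_nhdsWithin_of_mem_nhds (Ici_mem_nhds ((min_le_left _ _).trans_lt hct))⟩
      rcases min_choice c s with h | h <;> rw [h] <;> assumption
    · push Not at h
      exact ⟨t, ht, h s hs, le_rfl, mem_of_superset self_mem_nhdsWithin fun u hu => h u hu⟩
  obtain ⟨d, hdI, hds, hdt, hd⟩ : ∃ d ∈ I, s ≤ d ∧ t ≤ d ∧ Iic d ∈ 𝓝[I] t := by
    by_cases h : ∃ d ∈ I, t < d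
    · obtain ⟨d, hd, hdt⟩ := h
      refine ⟨max d s, ?_, le_max_right _ _, hdt.le.trans (le_max_left _ _),
        mem_nhdsWithin_of_mem_nhds (Iic_mem_nhds (hdt.trans_le (le_max_left _ _)))⟩
      rcases max_choice d s with h | h <;> rw [h] <;> assumption
    · push Not at h
      exact ⟨t, ht, h s hs, le_rfl, mem_of_superset self_mem_nhdsWithin fun u hu => h u hu⟩
  exact ⟨c, d, ⟨hcs, hds⟩, ⟨hct, hdt⟩, hI.out hcI hdI, inter_mem hc hd⟩

/-- A strongly continuous family of operators is bounded on compact intervals. -/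
lemma exists_norm_le_of_strong_continuousOn {𝕜 E F : Type*} [RCLike 𝕜] [NormedAddCommGroup E]
    [NormedSpace 𝕜 E] [CompleteSpace E] [NormedAddCommGroup F] [NormedSpace 𝕜 F]
    {X : ℝ → E →L[𝕜] F} {c d : ℝ}
    (hX : ∀ ξ, ContinuousOn (fun t => X t ξ) (Icc c d)) :
    ∃ K, 0 ≤ K ∧ ∀ t ∈ Icc c d, ‖X t‖ ≤ K := by
  obtain ⟨K, hK⟩ := banach_steinhaus (g := fun t : Icc c d => X t) fun ξ => by
    obtain ⟨C, hC⟩ := isCompact_Icc.exists_bound_of_continuousOn (hX ξ)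
    exact ⟨C, fun t => hC t t.2⟩
  exact ⟨max K 0, le_max_right _ _, fun t ht => (hK ⟨t, ht⟩).trans (le_max_left _ _)⟩

/-- Evaluation is jointly continuous on bounded sets of operators with the strong topology. -/
lemma tendsto_strong_apply {𝕜 E F ι : Type*} [RCLike 𝕜] [NormedAddCommGroup E]
    [NormedSpace 𝕜 E] [NormedAddCommGroup F] [NormedSpace 𝕜 F] {l : Filter ι}
    {X : ι → E →L[𝕜] F} {x : ι → E} {ξ : E} {η : F} {K : ℝ} (hK : ∀ᶠ i in l, ‖X i‖ ≤ K)
    (hX : Tendsto (fun i => X i ξ) l (𝓝 η)) (hx : Tendsto x l (𝓝 ξ)) :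
    Tendsto (fun i => X i (x i)) l (𝓝 η) := by
  have h1 : Tendsto (fun i => X i (x i - ξ)) l (𝓝 0) := by
    have h0 : Tendsto (fun i => K * ‖x i - ξ‖) l (𝓝 0) := by
      simpa using (tendsto_iff_norm_sub_tendsto_zero.1 hx).const_mul K
    refine squeeze_zero_norm' (hK.mono fun i hi => ?_) h0
    exact (X i).le_of_opNorm_le hi _
  simpa using h1.add hX

/-- A strongly continuous family of operators maps continuous curves to continuous curves. -/
lemma continuousOn_strong_apply {𝕜 E F : Type*} [RCLike 𝕜] [NormedAddCommGroup E]
    [NormedSpace 𝕜 E] [CompleteSpace E] [NormedAddCommGroup F] [NormedSpace 𝕜 F]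
    {I : Set ℝ} (hI : I.OrdConnected) {X : ℝ → E →L[𝕜] F} {x : ℝ → E}
    (hX : ∀ ξ, ContinuousOn (fun t => X t ξ) I) (hx : ContinuousOn x I) :
    ContinuousOn (fun t => X t (x t)) I := by
  intro t ht
  obtain ⟨c, d, -, -, hcd, hn⟩ := exists_Icc_mem_nhdsWithin hI ht ht
  obtain ⟨K, -, hK⟩ := exists_norm_le_of_strong_continuousOn fun ξ => (hX ξ).mono hcd
  exact tendsto_strong_apply (mem_of_superset hn hK) (hX (x t) t ht) (hx t ht)

variable [CompleteSpace H]

/-- The fundamental theorem of calculus on an interval `I` of any kind. -/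
lemma hasDerivWithinAt_integral {I : Set ℝ} (hI : I.OrdConnected) {f : ℝ → H}
    (hf : ContinuousOn f I) {s t : ℝ} (hs : s ∈ I) (ht : t ∈ I) :
    HasDerivWithinAt (fun u => ∫ v in s..u, f v) (f t) I t := by
  obtain ⟨c, d, -, htc, hcd, hn⟩ := exists_Icc_mem_nhdsWithin hI ht ht
  refine HasDerivWithinAt.mono_of_mem_nhdsWithin ?_ hn
  have : Fact (t ∈ Icc c d) := ⟨htc⟩
  exact intervalIntegral.integral_hasDerivWithinAt_right
    (hf.mono (hI.uIcc_subset hs ht)).intervalIntegrable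
    ((hf.mono hcd).stronglyMeasurableAtFilter_nhdsWithin measurableSet_Icc t)
    ((hf.mono hcd) t htc)

/-- The terms of the Dyson series of the linear equation `γ' = X γ`, `γ s = x`. -/
noncomputable def dysonTerm (X : ℝ → H →L[ℝ] H) (s : ℝ) (x : H) : ℕ → ℝ → H
  | 0 => fun _ => x
  | n + 1 => fun t => ∫ u in s..t, X u (dysonTerm X s x n u)

lemma continuousOn_dysonTerm {I : Set ℝ} (hI : I.OrdConnected) {X : ℝ → H →L[ℝ] H}
    (hX : ∀ ξ, ContinuousOn (fun t => X t ξ) I) {s : ℝ} (hs : s ∈ I) (x : H) (n : ℕ) :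
    ContinuousOn (dysonTerm X s x n) I := by
  induction n with
  | zero => exact continuousOn_const
  | succ n ih => exact fun t ht =>
      (hasDerivWithinAt_integral hI (continuousOn_strong_apply hI hX ih) hs ht).continuousWithinAt

/-- The factorial bound for the terms of the Dyson series, for the gauge `x ↦ sup_{φ ∈ P} |φ x|` of
a set `P` of functionals. -/
lemma abs_dysonTerm_le {I : Set ℝ} (hI : I.OrdConnected) {X : ℝ → H →L[ℝ] H}
    (hX : ∀ ξ, ContinuousOn (fun t => X t ξ) I) {P : Set (H →L[ℝ] ℝ)} {c d K : ℝ}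
    (hcd : Icc c d ⊆ I) (hK0 : 0 ≤ K)
    (hK : ∀ t ∈ Icc c d, ∀ r, 0 ≤ r → ∀ x, (∀ φ ∈ P, |φ x| ≤ r) → ∀ φ ∈ P, |φ (X t x)| ≤ K * r)
    {s : ℝ} (hs : s ∈ Icc c d) {x : H} {r : ℝ} (hr : 0 ≤ r) (hx : ∀ φ ∈ P, |φ x| ≤ r) (n : ℕ) :
    ∀ t ∈ Icc c d, ∀ φ ∈ P,
      |φ (dysonTerm X s x n t)| ≤ r * ((K * |t - s|) ^ n / n.factorial) := by
  induction n with
  | zero => simpa [dysonTerm] using fun t _ _ => hx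
  | succ n ih =>
    intro t ht φ hφ
    have hsub : uIcc s t ⊆ Icc c d := uIcc_subset_Icc hs ht
    have hcont := continuousOn_strong_apply hI hX (continuousOn_dysonTerm hI hX (hcd hs) x n)
    have hint : IntervalIntegrable (fun u => X u (dysonTerm X s x n u)) volume s t :=
      (hcont.mono (hsub.trans hcd)).intervalIntegrable
    have hb : ∀ u ∈ uIoc s t, ‖φ (X u (dysonTerm X s x n u))‖
        ≤ K ^ (n + 1) * r / n.factorial * |u - s| ^ n := by
      intro u hu
      have hu' := hsub (uIoc_subset_uIcc hu)
      refine (hK u hu' _ (by positivity) _ (ih u hu') φ hφ).trans_eq ?_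
      rw [mul_pow]; ring
    have hg : Continuous fun u : ℝ => K ^ (n + 1) * r / n.factorial * |u - s| ^ n := by fun_prop
    have h1 := intervalIntegral.norm_integral_le_abs_of_norm_le (μ := volume)
      ((ae_restrict_iff' measurableSet_uIoc).2 (.of_forall hb)) (hg.intervalIntegrable s t)
    rw [dysonTerm, ← Real.norm_eq_abs, ← φ.intervalIntegral_comp_comm hint]
    refine h1.trans_eq ?_
    rw [intervalIntegral.abs_intervalIntegral_eq, integral_const_mul, integral_pow_abs_sub_uIoc,
      abs_of_nonneg (by positivity), Nat.factorial_succ, mul_pow]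
    push_cast
    field_simp

/-- The factorial bound in norm: the norm is the gauge of the unit ball of the dual. -/
lemma norm_dysonTerm_le {I : Set ℝ} (hI : I.OrdConnected) {X : ℝ → H →L[ℝ] H}
    (hX : ∀ ξ, ContinuousOn (fun t => X t ξ) I) {c d K : ℝ}
    (hcd : Icc c d ⊆ I) (hK0 : 0 ≤ K) (hK : ∀ t ∈ Icc c d, ‖X t‖ ≤ K)
    {s : ℝ} (hs : s ∈ Icc c d) (x : H) (n : ℕ) {t : ℝ} (ht : t ∈ Icc c d) :
    ‖dysonTerm X s x n t‖ ≤ ‖x‖ * ((K * |t - s|) ^ n / n.factorial) := by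
  have dual (y : H) (r : ℝ) (hr : 0 ≤ r) :
      (∀ φ ∈ {φ : H →L[ℝ] ℝ | ‖φ‖ ≤ 1}, |φ y| ≤ r) ↔ ‖y‖ ≤ r := by
    refine ⟨fun h => ?_, fun h φ hφ => (φ.le_of_opNorm_le hφ y).trans (by simpa using h)⟩
    obtain ⟨φ, h1, h2⟩ := exists_dual_vector'' ℝ y
    have := h φ h1
    rw [h2] at this
    simpa using this
  rw [← dual _ _ (by positivity)]
  refine abs_dysonTerm_le hI hX hcd hK0 (fun t ht r hr x hx => ?_) hs (norm_nonneg x)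
    ((dual _ _ (norm_nonneg x)).2 le_rfl) n t ht
  rw [dual _ _ hr] at hx
  rw [dual _ _ (by positivity)]
  exact (X t).le_of_opNorm_le_of_le (hK t ht) hx

/-- The sum of the Dyson series solves `γ' = X γ`, `γ s = x` on all of `I`. A gauge that is bounded
along `X` on compact subintervals grows at most by a constant factor along `γ`. -/
theorem exists_linear_ode_solution {I : Set ℝ} (hI : I.OrdConnected) {X : ℝ → H →L[ℝ] H}
    (hX : ∀ ξ, ContinuousOn (fun t => X t ξ) I) {P : Set (H →L[ℝ] ℝ)}
    (hP : ∀ c d, Icc c d ⊆ I → ∃ K, 0 ≤ K ∧ ∀ t ∈ Icc c d, ∀ r, 0 ≤ r → ∀ x,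
      (∀ φ ∈ P, |φ x| ≤ r) → ∀ φ ∈ P, |φ (X t x)| ≤ K * r)
    {s : ℝ} (hs : s ∈ I) (x : H) :
    ∃ γ : ℝ → H, γ s = x ∧ (∀ t ∈ I, HasDerivWithinAt γ (X t (γ t)) I t) ∧
      ∀ c d, Icc c d ⊆ I → s ∈ Icc c d → ∃ C, 0 ≤ C ∧ ∀ r, 0 ≤ r → (∀ φ ∈ P, |φ x| ≤ r) →
        ∀ t ∈ Icc c d, ∀ φ ∈ P, |φ (γ t)| ≤ C * r := by
  set γ : ℝ → H := fun t => ∑' n, dysonTerm X s x n t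
  have bound (c d : ℝ) (hcd : Icc c d ⊆ I) (hsc : s ∈ Icc c d) :
      ∃ u : ℕ → ℝ, Summable u ∧ ∀ n, ∀ t ∈ Icc c d, ‖dysonTerm X s x n t‖ ≤ u n := by
    obtain ⟨K, hK0, hK⟩ := exists_norm_le_of_strong_continuousOn fun ξ => (hX ξ).mono hcd
    refine ⟨fun n => ‖x‖ * ((K * (d - c)) ^ n / n.factorial),
      (Real.summable_pow_div_factorial _).mul_left _, fun n t ht => ?_⟩
    refine (norm_dysonTerm_le hI hX hcd hK0 hK hsc x n ht).trans ?_
    have : |t - s| ≤ d - c := by rw [abs_le]; constructor <;> linarith [ht.1, ht.2, hsc.1, hsc.2]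
    beta_reduce
    gcongr
  have hsum : ∀ t ∈ I, HasSum (fun n => dysonTerm X s x n t) (γ t) := by
    intro t ht
    obtain ⟨c, d, hsc, htc, hcd, -⟩ := exists_Icc_mem_nhdsWithin hI hs ht
    obtain ⟨u, hu, hb⟩ := bound c d hcd hsc
    exact (hu.of_norm_bounded fun n => hb n t htc).hasSum
  have hcont : ContinuousOn γ I := by
    intro t ht
    obtain ⟨c, d, hsc, htc, hcd, hn⟩ := exists_Icc_mem_nhdsWithin hI hs ht
    obtain ⟨u, hu, hb⟩ := bound c d hcd hsc
    exact ((continuousOn_tsum (fun n => (continuousOn_dysonTerm hI hX hs x n).mono hcd) hu hb)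
      t htc).mono_of_mem_nhdsWithin hn
  have hXcont := continuousOn_strong_apply hI hX hcont
  have hinteq : ∀ t ∈ I, γ t = x + ∫ u in s..t, X u (γ u) := by
    intro t ht
    have hsub : uIcc s t ⊆ I := hI.uIcc_subset hs ht
    obtain ⟨u, hu, hb⟩ := bound (min s t) (max s t) hsub left_mem_uIcc
    obtain ⟨K, hK0, hK⟩ := exists_norm_le_of_strong_continuousOn
      (c := min s t) (d := max s t) fun ξ => (hX ξ).mono hsub
    have h1 : HasSum (fun n => ∫ v in s..t, X v (dysonTerm X s x n v))
        (∫ v in s..t, X v (γ v)) := by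
      refine intervalIntegral.hasSum_integral_of_dominated_convergence (fun n _ => K * u n)
        (fun n => ?_) (fun n => .of_forall fun v hv => ?_) (.of_forall fun v _ => hu.mul_left K)
        (by simp) (.of_forall fun v hv => ?_)
      · exact (((continuousOn_strong_apply hI hX (continuousOn_dysonTerm hI hX hs x n)).mono
          hsub).mono uIoc_subset_uIcc).aestronglyMeasurable measurableSet_uIoc
      · have hv' := uIoc_subset_uIcc hv
        exact (X v).le_of_opNorm_le_of_le (hK v hv') (hb n v hv')
      · exact (hsum v (hsub (uIoc_subset_uIcc hv))).mapL (X v)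
    have h2 := (hasSum_nat_add_iff' 1).2 (hsum t ht)
    have h3 := h2.unique h1
    simp only [Finset.range_one, Finset.sum_singleton, dysonTerm] at h3
    rw [← h3]; abel
  refine ⟨γ, by simpa using hinteq s hs, fun t ht => ?_, fun c d hcd hsc => ?_⟩
  · exact ((hasDerivWithinAt_integral hI hXcont hs ht).const_add x).congr hinteq (hinteq t ht)
  · obtain ⟨K, hK0, hK⟩ := hP c d hcd
    refine ⟨Real.exp (K * (d - c)), (Real.exp_pos _).le, fun r hr hx t ht φ hφ => ?_⟩
    have h1 : HasSum (fun n => φ (dysonTerm X s x n t)) (φ (γ t)) := (hsum t (hcd ht)).mapL φ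
    have h2 : HasSum (fun n : ℕ => r * ((K * |t - s|) ^ n / n.factorial))
        (r * Real.exp (K * |t - s|)) := by
      rw [Real.exp_eq_exp_ℝ]
      exact (NormedSpace.expSeries_div_hasSum_exp (K * |t - s|)).mul_left r
    have h3 := h1.norm_le_of_bounded h2 fun n =>
      abs_dysonTerm_le hI hX hcd hK0 hK hsc hr hx n t ht φ hφ
    have : |t - s| ≤ d - c := by rw [abs_le]; constructor <;> linarith [ht.1, ht.2, hsc.1, hsc.2]
    refine h3.trans ?_
    rw [mul_comm]
    gcongr

end LinearODE

/-! ### Weak solutions of skew-adjoint equations -/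

section WeakSolutions

open Filter Topology

variable {H : Type*} [NormedAddCommGroup H] [InnerProductSpace ℂ H] [CompleteSpace H]

/-- Product rule for the inner product of a weakly differentiable curve and a differentiable one.
The weakly differentiable curve is locally bounded by the uniform boundedness principle. -/
lemma hasDerivWithinAt_inner_of_weak {I : Set ℝ} (hI : I.OrdConnected) {β γ : ℝ → H} {γ' : H}
    {β' : ℝ → H}
    (hβ : ∀ ξ, ∀ t ∈ I, HasDerivWithinAt (fun u => ⟪ξ, β u⟫_ℂ) ⟪ξ, β' t⟫_ℂ I t) {t : ℝ} (ht : t ∈ I)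
    (hγ : HasDerivWithinAt γ γ' I t) :
    HasDerivWithinAt (fun u => ⟪β u, γ u⟫_ℂ) (⟪β' t, γ t⟫_ℂ + ⟪β t, γ'⟫_ℂ) I t := by
  have hβ2 : ∀ ξ, ∀ t ∈ I, HasDerivWithinAt (fun u => ⟪β u, ξ⟫_ℂ) ⟪β' t, ξ⟫_ℂ I t := by
    intro ξ t ht
    simpa only [← starRingEnd_apply, inner_conj_symm] using (hβ ξ t ht).star
  obtain ⟨c, d, -, -, hcd, hn⟩ := exists_Icc_mem_nhdsWithin hI ht ht
  obtain ⟨K, -, hK⟩ := exists_norm_le_of_strong_continuousOn (X := fun u => innerSL ℂ (β u))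
    (c := c) (d := d) fun ξ u hu =>
      ((hβ2 ξ u (hcd hu)).continuousWithinAt).mono hcd
  rw [hasDerivWithinAt_iff_tendsto_slope]
  have hle : 𝓝[I \ {t}] t ≤ 𝓝[I] t := nhdsWithin_mono _ sdiff_subset
  have h1 := hasDerivWithinAt_iff_tendsto_slope.1 (hβ2 (γ t) t ht)
  have h2 : Tendsto (fun u => innerSL ℂ (β u) (slope γ t u)) (𝓝[I \ {t}] t) (𝓝 ⟪β t, γ'⟫_ℂ) :=
    tendsto_strong_apply (hle (mem_of_superset hn hK))
      (((hβ2 γ' t ht).continuousWithinAt).mono_left hle)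
      (hasDerivWithinAt_iff_tendsto_slope.1 hγ)
  refine (h1.add h2).congr fun u => ?_
  simp only [slope, vsub_eq_sub, innerSL_apply_apply, inner_smul_right_eq_smul, inner_sub_right,
    ← smul_add]
  congr 1; ring

/-- For a skew-adjoint generator, the inner product of a weak solution and a solution is
constant. -/
lemma inner_eq_of_weak_solution {I : Set ℝ} (hI : I.OrdConnected) {X : ℝ → H →L[ℂ] H}
    (hskew : ∀ t ∈ I, ∀ ξ η, ⟪X t ξ, η⟫_ℂ = -⟪ξ, X t η⟫_ℂ) {β γ : ℝ → H}
    (hβ : ∀ ξ, ∀ t ∈ I, HasDerivWithinAt (fun u => ⟪ξ, β u⟫_ℂ) ⟪ξ, X t (β t)⟫_ℂ I t)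
    (hγ : ∀ t ∈ I, HasDerivWithinAt γ (X t (γ t)) I t) {s t : ℝ} (hs : s ∈ I) (ht : t ∈ I) :
    ⟪β t, γ t⟫_ℂ = ⟪β s, γ s⟫_ℂ := by
  have h := Convex.norm_image_sub_le_of_norm_hasDerivWithin_le (C := 0)
    (f := fun u => ⟪β u, γ u⟫_ℂ)
    (fun u hu => hasDerivWithinAt_inner_of_weak hI (β' := fun u => X u (β u)) hβ hu (hγ u hu))
    (fun u hu => by simp [hskew u hu]) hI.convex hs ht
  rw [zero_mul, norm_le_zero_iff, sub_eq_zero] at h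
  exact h

/-- Weak solutions of a skew-adjoint linear equation are determined by their initial value: the
solution through `β t` at time `t` has a constant inner product with `β`. -/
lemma eq_zero_of_weak_solution {I : Set ℝ} (hI : I.OrdConnected) {X : ℝ → H →L[ℂ] H}
    (hX : ∀ ξ, ContinuousOn (fun t => X t ξ) I)
    (hskew : ∀ t ∈ I, ∀ ξ η, ⟪X t ξ, η⟫_ℂ = -⟪ξ, X t η⟫_ℂ) {β : ℝ → H}
    (hβ : ∀ ξ, ∀ t ∈ I, HasDerivWithinAt (fun u => ⟪ξ, β u⟫_ℂ) ⟪ξ, X t (β t)⟫_ℂ I t)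
    {s t : ℝ} (hs : s ∈ I) (ht : t ∈ I) (h0 : β s = 0) : β t = 0 := by
  obtain ⟨γ, hγt, hγ, -⟩ := exists_linear_ode_solution hI
    (X := fun t => (X t).restrictScalars ℝ) hX (P := ∅)
    (fun c d _ => ⟨0, le_rfl, by simp⟩) ht (β t)
  have h := inner_eq_of_weak_solution hI hskew hβ hγ hs ht
  rw [h0, hγt, inner_zero_left] at h
  exact inner_self_eq_zero.1 h

/-- A criterion for `C¹` which applies also where derivatives within `I` are not unique, as for a
one-point interval. -/
lemma contDiffOn_one_of_hasDerivWithinAt {F : Type*} [NormedAddCommGroup F] [NormedSpace ℝ F]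
    {I : Set ℝ} {f f' : ℝ → F} (hf : ∀ t ∈ I, HasDerivWithinAt f (f' t) I t)
    (hf' : ContinuousOn f' I) : ContDiffOn ℝ 1 f I := by
  rw [← zero_add 1, contDiffOn_succ_iff_hasFDerivWithinAt (by simp)]
  intro t ht
  refine ⟨I, by rw [insert_eq_of_mem ht]; exact self_mem_nhdsWithin, by simp,
    fun u => ContinuousLinearMap.toSpanSingleton ℝ (f' u), fun u hu => hf u hu, ?_⟩
  rw [contDiffOn_zero]
  exact (ContinuousLinearMap.toSpanSingletonCLE (𝕜 := ℝ) (E := F)).continuous.comp_continuousOn hf'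

end WeakSolutions

/-! ### The inclusion of a finite von Neumann algebra in its `L²` space -/

section L2

open Filter Topology

variable {A : Type*} [CStarAlgebra A] [PartialOrder A] [StarOrderedRing A] {τ : A →ₚ[ℂ] ℂ}

variable (τ) in
/-- The inclusion `A ⊆ L²(A, τ)` as a linear map. -/
noncomputable def toL2Linear : A →ₗ[ℂ] τ.GNS where
  toFun := toL2 τ
  map_add' a b := by simp [toL2, UniformSpace.Completion.coe_add]
  map_smul' c a := by simp [toL2, UniformSpace.Completion.coe_smul]

lemma toL2_add (a b : A) : toL2 τ (a + b) = toL2 τ a + toL2 τ b := (toL2Linear τ).map_add a b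

lemma toL2_sub (a b : A) : toL2 τ (a - b) = toL2 τ a - toL2 τ b := (toL2Linear τ).map_sub a b

lemma toL2_neg (a : A) : toL2 τ (-a) = -toL2 τ a := (toL2Linear τ).map_neg a

lemma toL2_zero : toL2 τ 0 = 0 := (toL2Linear τ).map_zero

lemma toL2_smul (c : ℂ) (a : A) : toL2 τ (c • a) = c • toL2 τ a := (toL2Linear τ).map_smul c a

lemma toL2_real_smul (c : ℝ) (a : A) : toL2 τ (c • a) = c • toL2 τ a := by
  rw [← Complex.coe_smul, toL2_smul, Complex.coe_smul]

lemma inner_toL2 (a b : A) : ⟪toL2 τ a, toL2 τ b⟫_ℂ = τ (star a * b) := by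
  rw [toL2, toL2, UniformSpace.Completion.inner_coe, PositiveLinearMap.preGNS_inner_def]
  rfl

lemma norm_toL2_sq (a : A) : ((‖toL2 τ a‖ ^ 2 : ℝ) : ℂ) = τ (star a * a) := by
  rw [← inner_toL2, inner_self_eq_norm_sq_to_K]; simp

lemma gns_apply_toL2 (a b : A) : τ.gnsStarAlgHom a (toL2 τ b) = toL2 τ (a * b) := by
  simp [toL2]

lemma gns_apply_toL2_one (a : A) : τ.gnsStarAlgHom a (toL2 τ 1) = toL2 τ a := by
  rw [gns_apply_toL2, mul_one]

lemma denseRange_toL2 : DenseRange (toL2 τ) :=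
  (UniformSpace.Completion.denseRange_coe (α := τ.PreGNS)).comp
    τ.toPreGNS.surjective.denseRange (UniformSpace.Completion.continuous_coe _)

lemma norm_gns_le (a : A) : ‖τ.gnsStarAlgHom a‖ ≤ ‖a‖ :=
  NonUnitalStarAlgHom.norm_apply_le τ.gnsStarAlgHom a

lemma norm_toL2_mul_le_left (a b : A) : ‖toL2 τ (a * b)‖ ≤ ‖a‖ * ‖toL2 τ b‖ := by
  rw [← gns_apply_toL2]
  exact (τ.gnsStarAlgHom a).le_of_opNorm_le (norm_gns_le a) _

lemma norm_toL2_le (a : A) : ‖toL2 τ a‖ ≤ ‖a‖ * ‖toL2 τ 1‖ := by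
  simpa using norm_toL2_mul_le_left (τ := τ) a 1

lemma continuous_toL2 : Continuous (toL2 τ) :=
  AddMonoidHomClass.continuous_of_bound (toL2Linear τ) _ fun a => by
    rw [mul_comm]; exact norm_toL2_le a

namespace IsFaithfulTrace

variable (hτ : IsFaithfulTrace τ)
include hτ

lemma toL2_injective : Function.Injective (toL2 τ) := by
  intro a b h
  rw [← sub_eq_zero]
  refine hτ.faithful _ ?_
  rw [← norm_toL2_sq, toL2_sub, h]; simp

lemma gns_injective : Function.Injective τ.gnsStarAlgHom := by
  intro a b h
  apply hτ.toL2_injective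
  rw [← gns_apply_toL2_one, h, gns_apply_toL2_one]

lemma norm_gns (a : A) : ‖τ.gnsStarAlgHom a‖ = ‖a‖ :=
  NonUnitalStarAlgHom.norm_map τ.gnsStarAlgHom hτ.gns_injective a

lemma norm_toL2_star (a : A) : ‖toL2 τ (star a)‖ = ‖toL2 τ a‖ := by
  rw [← sq_eq_sq₀ (norm_nonneg _) (norm_nonneg _), ← Complex.ofReal_inj, norm_toL2_sq,
    norm_toL2_sq, star_star, hτ.tracial]

lemma norm_toL2_mul_le_right (a b : A) : ‖toL2 τ (a * b)‖ ≤ ‖b‖ * ‖toL2 τ a‖ := by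
  rw [← hτ.norm_toL2_star, star_mul, ← hτ.norm_toL2_star a, ← norm_star b]
  exact norm_toL2_mul_le_left _ _

end IsFaithfulTrace

/-- Strong limits of elements of a von Neumann algebra belong to it: they commute with the
commutant. -/
lemma IsVonNeumannOnL2.exists_of_tendsto (hA : IsVonNeumannOnL2 τ ⊤) {ι : Type*} {l : Filter ι}
    [l.NeBot] {f : ι → A} {T : τ.GNS →L[ℂ] τ.GNS}
    (hT : ∀ ξ, Tendsto (fun i => τ.gnsStarAlgHom (f i) ξ) l (𝓝 (T ξ))) :
    ∃ a, τ.gnsStarAlgHom a = T := by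
  obtain ⟨M, hM⟩ := hA
  have hmem : T ∈ M := by
    rw [← M.commutant_commutant, VonNeumannAlgebra.mem_commutant_iff]
    intro S hS
    ext ξ
    refine tendsto_nhds_unique ((S.continuous.tendsto _).comp (hT ξ)) ((hT (S ξ)).congr fun i => ?_)
    have h1 : τ.gnsStarAlgHom (f i) ∈ M := by
      rw [← SetLike.mem_coe, hM]; exact ⟨f i, trivial, rfl⟩
    exact DFunLike.congr_fun (VonNeumannAlgebra.mem_commutant_iff.1 hS _ h1) ξ
  rw [← SetLike.mem_coe, hM] at hmem
  obtain ⟨a, -, ha⟩ := hmem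
  exact ⟨a, ha⟩

/-- The unit ball of `A` is closed in `L²(A, τ)`: by traciality, a `‖·‖₂`-convergent sequence in it
converges strongly as a sequence of operators. -/
lemma isClosed_image_unitBall (hτ : IsFaithfulTrace τ) (hA : IsVonNeumannOnL2 τ ⊤) :
    IsClosed (toL2 τ '' {a | ‖a‖ ≤ 1}) := by
  refine IsSeqClosed.isClosed fun x y hx hxy => ?_
  choose a ha hax using hx
  have hbd (n) : ‖τ.gnsStarAlgHom (a n)‖ ≤ 1 := (norm_gns_le _).trans (ha n)
  have hcauchy (b : A) : CauchySeq fun n => τ.gnsStarAlgHom (a n) (toL2 τ b) := by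
    refine Metric.cauchySeq_iff'.2 fun ε hε => ?_
    obtain ⟨N, hN⟩ := Metric.cauchySeq_iff'.1 hxy.cauchySeq (ε / (‖b‖ + 1)) (by positivity)
    refine ⟨N, fun n hn => ?_⟩
    have h1 := hN n hn
    rw [← hax, ← hax, dist_eq_norm, ← toL2_sub, lt_div_iff₀ (by positivity)] at h1
    rw [gns_apply_toL2, gns_apply_toL2, dist_eq_norm, ← toL2_sub, ← sub_mul]
    refine (hτ.norm_toL2_mul_le_right _ _).trans_lt (lt_of_le_of_lt ?_ h1)
    rw [mul_comm]
    gcongr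
    linarith
  have hlim (ξ : τ.GNS) : ∃ η, Tendsto (fun n => τ.gnsStarAlgHom (a n) ξ) atTop (𝓝 η) := by
    refine cauchySeq_tendsto_of_complete (Metric.cauchySeq_iff'.2 fun ε hε => ?_)
    obtain ⟨b, hb⟩ := denseRange_toL2.exists_dist_lt ξ (ε := ε / 3) (by positivity)
    obtain ⟨N, hN⟩ := Metric.cauchySeq_iff'.1 (hcauchy b) (ε / 3) (by positivity)
    refine ⟨N, fun n hn => ?_⟩
    have h1 (n) : dist (τ.gnsStarAlgHom (a n) ξ) (τ.gnsStarAlgHom (a n) (toL2 τ b)) < ε / 3 := by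
      rw [dist_eq_norm] at hb ⊢
      rw [← map_sub]
      exact ((τ.gnsStarAlgHom (a n)).le_of_opNorm_le (hbd n) _).trans_lt (by simpa using hb)
    have h2 := dist_triangle4 (τ.gnsStarAlgHom (a n) ξ) (τ.gnsStarAlgHom (a n) (toL2 τ b))
      (τ.gnsStarAlgHom (a N) (toL2 τ b)) (τ.gnsStarAlgHom (a N) ξ)
    have h3 := h1 N
    rw [dist_comm] at h3
    linarith [h1 n, hN n hn]
  choose T hT using hlim
  obtain ⟨b, hb⟩ := hA.exists_of_tendsto (l := atTop) (f := a)
    (T := continuousLinearMapOfTendsto _ (tendsto_pi_nhds.2 hT)) hT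
  have hbT (ξ) : τ.gnsStarAlgHom b ξ = T ξ := by rw [hb]; rfl
  refine ⟨b, ?_, ?_⟩
  · rw [mem_ofPred_eq, ← hτ.norm_gns]
    refine ContinuousLinearMap.opNorm_le_bound _ zero_le_one fun ξ => ?_
    rw [hbT]
    exact le_of_tendsto (hT ξ).norm
      (.of_forall fun n => (τ.gnsStarAlgHom (a n)).le_of_opNorm_le (hbd n) ξ)
  · rw [← gns_apply_toL2_one, hbT]
    refine tendsto_nhds_unique (hT _) (hxy.congr fun n => ?_)
    rw [gns_apply_toL2_one, hax]

variable (τ) in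
/-- The polar of the unit ball of `A` in the real dual of `L²(A, τ)`. -/
def unitBallPolar : Set (τ.GNS →L[ℝ] ℝ) := {φ | ∀ a : A, ‖a‖ ≤ 1 → |φ (toL2 τ a)| ≤ 1}

lemma abs_apply_toL2_le {φ : τ.GNS →L[ℝ] ℝ} (hφ : φ ∈ unitBallPolar τ) (a : A) :
    |φ (toL2 τ a)| ≤ ‖a‖ := by
  rcases eq_or_ne a 0 with rfl | ha
  · simp [toL2_zero]
  · have hn : 0 < ‖a‖ := norm_pos_iff.2 ha
    have h := hφ (‖a‖⁻¹ • a) (by rw [norm_smul]; simp [hn.ne'])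
    rw [toL2_real_smul, map_smul, smul_eq_mul, abs_mul, abs_of_pos (inv_pos.2 hn),
      inv_mul_le_one₀ hn] at h
    exact h

/-- The bipolar theorem for the unit ball of `A` in `L²(A, τ)`. -/
lemma exists_toL2_eq_of_polar (hτ : IsFaithfulTrace τ) (hA : IsVonNeumannOnL2 τ ⊤) {x : τ.GNS}
    {r : ℝ} (hr : 0 < r) (hx : ∀ φ ∈ unitBallPolar τ, |φ x| ≤ r) :
    ∃ a, ‖a‖ ≤ r ∧ toL2 τ a = x := by
  suffices h : r⁻¹ • x ∈ toL2 τ '' {a | ‖a‖ ≤ 1} by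
    obtain ⟨a, ha, hax⟩ := h
    refine ⟨r • a, ?_, ?_⟩
    · rw [norm_smul, Real.norm_of_nonneg hr.le]
      exact mul_le_of_le_one_right hr.le ha
    · rw [toL2_real_smul, hax, smul_inv_smul₀ hr.ne']
  by_contra hnot
  have hconv : Convex ℝ (toL2 τ '' {a | ‖a‖ ≤ 1}) := by
    rintro _ ⟨a, ha, rfl⟩ _ ⟨b, hb, rfl⟩ p q hp hq hpq
    refine ⟨p • a + q • b, ?_, by rw [toL2_add, toL2_real_smul, toL2_real_smul]⟩
    have := (convex_closedBall (0 : A) 1) (mem_closedBall_zero_iff.2 ha)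
      (mem_closedBall_zero_iff.2 hb) hp hq hpq
    exact mem_closedBall_zero_iff.1 this
  obtain ⟨f, u, hf, hu⟩ :=
    geometric_hahn_banach_closed_point hconv (isClosed_image_unitBall hτ hA) hnot
  have hu0 : 0 < u := by simpa [toL2_zero] using hf _ ⟨0, by simp, rfl⟩
  have hφ : u⁻¹ • f ∈ unitBallPolar τ := by
    intro a ha
    have h1 := hf _ ⟨a, ha, rfl⟩
    have h2 := hf _ ⟨-a, by simpa using ha, rfl⟩
    rw [toL2_neg, map_neg] at h2
    rw [smul_apply, smul_eq_mul, abs_mul, abs_of_pos (inv_pos.2 hu0),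
      inv_mul_le_one₀ hu0, abs_le]
    constructor <;> linarith
  have h := (le_abs_self _).trans (hx _ hφ)
  rw [smul_apply, smul_eq_mul, inv_mul_le_iff₀ hu0] at h
  rw [map_smul, smul_eq_mul, lt_inv_mul_iff₀ hr] at hu
  linarith [mul_comm u r]

/-- An operator on `A` that is bounded for the norm of `A` and symmetric for the inner product of
`L²(A, τ)` is bounded for the `L²` norm, with the same bound. Indeed `‖Tⁿ a‖₂` is log-convex in `n`
by the Cauchy–Schwarz inequality, and grows at most like `Kⁿ`. -/
lemma norm_toL2_apply_le_of_symmetric {T : A →ₗ[ℂ] A} {K : ℝ} (hK0 : 0 ≤ K)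
    (hK : ∀ a, ‖T a‖ ≤ K * ‖a‖)
    (hT : ∀ a b, ⟪toL2 τ (T a), toL2 τ b⟫_ℂ = ⟪toL2 τ a, toL2 τ (T b)⟫_ℂ) (a : A) :
    ‖toL2 τ (T a)‖ ≤ K * ‖toL2 τ a‖ := by
  set c : ℕ → ℝ := fun n => ‖toL2 τ ((T ^ n) a)‖ with hc
  have hc0 (n) : 0 ≤ c n := norm_nonneg _
  have hsucc (n) : (T ^ (n + 1)) a = T ((T ^ n) a) := by rw [pow_succ']; rfl
  have hconv (n) : c (n + 1) ^ 2 ≤ c n * c (n + 2) := by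
    have h1 : ((c (n + 1) ^ 2 : ℝ) : ℂ) = ⟪toL2 τ ((T ^ n) a), toL2 τ ((T ^ (n + 2)) a)⟫_ℂ := by
      rw [hsucc (n + 1), ← hT, ← hsucc, inner_self_eq_norm_sq_to_K]; simp [hc]
    have h2 := norm_inner_le_norm (𝕜 := ℂ) (toL2 τ ((T ^ n) a)) (toL2 τ ((T ^ (n + 2)) a))
    rw [← h1, Complex.norm_real, Real.norm_of_nonneg (by positivity)] at h2
    exact h2
  have hgrow (n) : c n ≤ K ^ n * (‖a‖ * ‖toL2 τ 1‖) := by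
    have : ‖(T ^ n) a‖ ≤ K ^ n * ‖a‖ := by
      induction n with
      | zero => simp
      | succ n ih =>
        rw [hsucc, pow_succ', mul_assoc]
        exact (hK _).trans (by gcongr)
    rw [← mul_assoc]
    exact (norm_toL2_le _).trans (by gcongr)
  change c 1 ≤ K * c 0
  by_contra! hlt
  have hc1 : 0 < c 1 := lt_of_le_of_lt (by positivity) hlt
  have hc00 : 0 < c 0 := by
    refine (hc0 0).lt_of_ne fun h => ?_
    have := hconv 0
    rw [← h, zero_mul] at this
    nlinarith
  -- The ratios `c (n + 1) / c n` increase, hence stay above `c 1 / c 0 > K`.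
  have hpos : ∀ n, 0 < c n ∧ c 1 * c n ≤ c 0 * c (n + 1) := by
    intro n
    induction n with
    | zero => exact ⟨hc00, (mul_comm _ _).le⟩
    | succ n ih =>
      obtain ⟨h1, h2⟩ := ih
      have h3 : 0 < c (n + 1) := by
        by_contra! h
        have : c 0 * c (n + 1) ≤ 0 := mul_nonpos_of_nonneg_of_nonpos hc00.le h
        have : 0 < c 1 * c n := by positivity
        linarith
      refine ⟨h3, ?_⟩
      have h4 : c 1 * c (n + 1) * c n ≤ c 0 * c (n + 2) * c n := by
        have := mul_le_mul_of_nonneg_left (hconv n) hc00.le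
        nlinarith [mul_le_mul_of_nonneg_right h2 h3.le]
      exact le_of_mul_le_mul_right h4 h1
  set q := c 1 / c 0 with hq
  have hqK : K < q := by rw [hq, lt_div_iff₀ hc00]; exact hlt
  have hq0 : 0 < q := hK0.trans_lt hqK
  have hlow (n) : q ^ n * c 0 ≤ c n := by
    induction n with
    | zero => simp
    | succ n ih =>
      have h1 := (hpos n).2
      have h2 : q * c n ≤ c (n + 1) := by
        rw [hq, div_mul_eq_mul_div, div_le_iff₀ hc00]; linarith [mul_comm (c 0) (c (n + 1))]
      calc q ^ (n + 1) * c 0 = q * (q ^ n * c 0) := by ring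
        _ ≤ q * c n := by gcongr
        _ ≤ c (n + 1) := h2
  have hlim : Tendsto (fun n : ℕ => (K / q) ^ n * (‖a‖ * ‖toL2 τ 1‖)) atTop (𝓝 0) := by
    simpa using (tendsto_pow_atTop_nhds_zero_of_lt_one (by positivity)
      ((div_lt_one hq0).2 hqK)).mul_const (‖a‖ * ‖toL2 τ 1‖)
  have : c 0 ≤ 0 := by
    refine ge_of_tendsto' hlim fun n => ?_
    rw [div_pow, div_mul_eq_mul_div, le_div_iff₀ (by positivity), mul_comm]
    exact (hlow n).trans (hgrow n)
  linarith

end L2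

/-! ### Conditional expectations and their derivatives -/

section CondExp

open Filter Topology

variable {A : Type*} [CStarAlgebra A] [PartialOrder A] {τ : A →ₚ[ℂ] ℂ}

namespace IsTraceCondExp

variable {B : StarSubalgebra ℂ A} {E : A →ₗ[ℂ] A} (hE : IsTraceCondExp τ B E)
include hE

lemma map_one : E 1 = 1 := hE.map_of_mem 1 (one_mem B)

lemma idempotent (a : A) : E (E a) = E a := hE.map_of_mem _ (hE.mem a)

lemma map_mul_left {b : A} (hb : b ∈ B) (a : A) : E (b * a) = b * E a := by
  simpa using hE.bimodule b hb 1 (one_mem B) a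

lemma map_mul_right {c : A} (hc : c ∈ B) (a : A) : E (a * c) = E a * c := by
  simpa using hE.bimodule 1 (one_mem B) c hc a

variable [StarOrderedRing A]

lemma map_star (a : A) : E (star a) = star (E a) :=
  StarHomClass.map_star (PositiveLinearMap.mk₀ E hE.nonneg) a

/-- The Kadison–Schwarz inequality, from positivity of `E ((a - E a)* (a - E a))`. -/
lemma star_mul_self_le (a : A) : star (E a) * E a ≤ E (star a * a) := by
  have h := hE.nonneg _ (star_mul_self_nonneg (a - E a))
  rw [star_sub, sub_mul, mul_sub, mul_sub, map_sub, map_sub, map_sub,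
    hE.map_mul_right (hE.mem a), hE.map_mul_left (star_mem (hE.mem a)),
    hE.map_of_mem _ (mul_mem (star_mem (hE.mem a)) (hE.mem a)), hE.map_star, sub_self,
    sub_zero] at h
  exact sub_nonneg.1 h

lemma norm_le (a : A) : ‖E a‖ ≤ ‖a‖ := by
  have h1 : E (star a * a) ≤ algebraMap ℝ A (‖a‖ ^ 2) := by
    have h2 : star a * a ≤ algebraMap ℝ A (‖a‖ ^ 2) := by
      rw [sq, ← CStarRing.norm_star_mul_self]
      exact IsSelfAdjoint.le_algebraMap_norm_self (.star_mul_self a)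
    have h3 := hE.nonneg _ (sub_nonneg.2 h2)
    rw [map_sub, sub_nonneg] at h3
    refine h3.trans_eq ?_
    rw [Algebra.algebraMap_eq_smul_one, ← Complex.coe_smul, map_smul, hE.map_one]
  have h4 := CStarAlgebra.norm_le_norm_of_nonneg_of_le (star_mul_self_nonneg (E a))
    ((hE.star_mul_self_le a).trans h1)
  rw [CStarRing.norm_star_mul_self] at h4
  rcases subsingleton_or_nontrivial A with _ | _
  · rw [Subsingleton.elim (E a) a]
  · rw [norm_algebraMap', Real.norm_of_nonneg (by positivity), ← sq] at h4
    exact (sq_le_sq₀ (norm_nonneg _) (norm_nonneg _)).1 h4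

lemma norm_toL2_le (a : A) : ‖toL2 τ (E a)‖ ≤ ‖toL2 τ a‖ := by
  rw [← sq_le_sq₀ (norm_nonneg _) (norm_nonneg _), ← Complex.real_le_real, norm_toL2_sq,
    norm_toL2_sq, ← hE.trace (star a * a)]
  exact OrderHomClass.mono τ (hE.star_mul_self_le a)

lemma inner_symm (a b : A) : ⟪toL2 τ (E a), toL2 τ b⟫_ℂ = ⟪toL2 τ a, toL2 τ (E b)⟫_ℂ := by
  rw [inner_toL2, inner_toL2, ← hE.trace, hE.map_mul_left (star_mem (hE.mem a)),
    ← hE.trace (star a * E b), hE.map_mul_right (hE.mem b), hE.map_star]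

end IsTraceCondExp

variable [StarOrderedRing A]

/-- The bounded extension to `L²(A, τ)` of a linear map on `A` that is bounded for the `L²` norm. -/
noncomputable def extendL2 (τ : A →ₚ[ℂ] ℂ) (F : A →ₗ[ℂ] A) : τ.GNS →L[ℂ] τ.GNS :=
  ((toL2Linear τ).comp F).extendOfNorm (toL2Linear τ)

lemma extendL2_toL2 {F : A →ₗ[ℂ] A} {K : ℝ} (hF : ∀ a, ‖toL2 τ (F a)‖ ≤ K * ‖toL2 τ a‖) (a : A) :
    extendL2 τ F (toL2 τ a) = toL2 τ (F a) :=
  LinearMap.extendOfNorm_eq (f := (toL2Linear τ).comp F) (e := toL2Linear τ) denseRange_toL2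
    ⟨K, hF⟩ a

lemma opNorm_le_of_toL2 {T : τ.GNS →L[ℂ] τ.GNS} {K : ℝ} (hK0 : 0 ≤ K)
    (hT : ∀ a, ‖T (toL2 τ a)‖ ≤ K * ‖toL2 τ a‖) : ‖T‖ ≤ K :=
  T.opNorm_le_bound hK0 fun ξ => denseRange_toL2.induction_on ξ
    (isClosed_le (by fun_prop) (by fun_prop)) hT

/-- Strong continuity of a locally bounded family need only be checked on `A ⊆ L²(A, τ)`. -/
lemma continuousOn_of_toL2 {I : Set ℝ} (hI : I.OrdConnected) {X : ℝ → τ.GNS →L[ℂ] τ.GNS}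
    (hb : ∀ c d, Icc c d ⊆ I → ∃ K, 0 ≤ K ∧ ∀ t ∈ Icc c d, ‖X t‖ ≤ K)
    (hX : ∀ a, ContinuousOn (fun t => X t (toL2 τ a)) I) (ξ : τ.GNS) :
    ContinuousOn (fun t => X t ξ) I := by
  intro t ht
  obtain ⟨c, d, -, -, hcd, hn⟩ := exists_Icc_mem_nhdsWithin hI ht ht
  obtain ⟨K, hK0, hK⟩ := hb c d hcd
  refine continuousWithinAt_of_locally_uniform_approx_of_continuousWithinAt ht fun u hu => ?_
  obtain ⟨ε, hε, hεu⟩ := Metric.mem_uniformity_dist.1 hu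
  obtain ⟨a, ha⟩ := denseRange_toL2.exists_dist_lt ξ (ε := ε / (K + 1)) (by positivity)
  refine ⟨_, hn, _, hX a t ht, fun v hv => hεu ?_⟩
  rw [lt_div_iff₀ (by positivity)] at ha
  rw [dist_eq_norm] at ha ⊢
  rw [← map_sub]
  refine ((X v).le_of_opNorm_le (hK v hv) _).trans_lt (lt_of_le_of_lt ?_ ha)
  rw [mul_comm]
  gcongr
  linarith

/-- The involution of `A` preserves differentiability in `L²(A, τ)`, since it is isometric there. -/
lemma IsFaithfulTrace.hasDerivWithinAt_star (hτ : IsFaithfulTrace τ) {I : Set ℝ} {α : ℝ → A} {x : A}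
    {t : ℝ} (h : HasDerivWithinAt (fun s => toL2 τ (α s)) (toL2 τ x) I t) :
    HasDerivWithinAt (fun s => toL2 τ (star (α s))) (toL2 τ (star x)) I t := by
  rw [hasDerivWithinAt_iff_isLittleO] at h ⊢
  refine (h.norm_left.congr_left fun s => ?_).of_norm_left
  simp only [← toL2_real_smul, ← toL2_sub]
  rw [← hτ.norm_toL2_star]
  simp

/-- The standing assumptions: `A` is a finite von Neumann algebra in standard representation and
`E` is a smooth path of trace preserving conditional expectations on the interval `I`. -/
structure IsSmoothExpectationPath (τ : A →ₚ[ℂ] ℂ) (I : Set ℝ) (B : ℝ → StarSubalgebra ℂ A)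
    (E : ℝ → A →ₗ[ℂ] A) : Prop where
  faithful : IsFaithfulTrace τ
  vonNeumann : IsVonNeumannOnL2 τ ⊤
  ordConnected : I.OrdConnected
  condExp : ∀ t ∈ I, IsTraceCondExp τ (B t) (E t)
  smooth : IsSmoothPath τ E I

namespace IsSmoothExpectationPath

variable {I : Set ℝ} {B : ℝ → StarSubalgebra ℂ A} {E : ℝ → A →ₗ[ℂ] A}
  (h : IsSmoothExpectationPath τ I B E)
include h

/-- `dE_t(a)` belongs to `A`: the difference quotients of `E_t(a)` converge strongly, and their
limit is a bounded operator by the Banach–Steinhaus theorem. At an isolated point of `I`, where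
`derivWithin` is zero, `dE_t(a) = 0`. -/
lemma gns_dE {t : ℝ} (ht : t ∈ I) (a : A) (ξ : τ.GNS) :
    τ.gnsStarAlgHom (dE τ E I t a) ξ = derivOp τ E I t a ξ := by
  have hex : ∃ x : A, ∀ ξ : τ.GNS, τ.gnsStarAlgHom x ξ = derivOp τ E I t a ξ := by
    by_cases hacc : AccPt t (𝓟 I)
    · have : (𝓝[I \ {t}] t).NeBot := accPt_principal_iff_nhdsWithin.1 hacc
      have hT (ξ : τ.GNS) : Tendsto (fun s => τ.gnsStarAlgHom (slope (fun s => E s a) t s) ξ)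
          (𝓝[I \ {t}] t) (𝓝 (derivOp τ E I t a ξ)) := by
        have hd := ((h.smooth a ξ).differentiableOn one_ne_zero t ht).hasDerivWithinAt
        refine (hasDerivWithinAt_iff_tendsto_slope.1 hd).congr fun s => ?_
        simp only [slope, vsub_eq_sub, ← Complex.coe_smul, map_smul, map_sub]
        simp
      obtain ⟨x, hx⟩ := h.vonNeumann.exists_of_tendsto
        (T := continuousLinearMapOfTendsto _ (tendsto_pi_nhds.2 hT)) hT
      exact ⟨x, fun ξ => by rw [hx]; rfl⟩
    · exact ⟨0, fun ξ => by rw [derivOp, derivWithin_zero_of_not_accPt hacc]; simp⟩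
  rw [dE, dif_pos hex]
  exact hex.choose_spec ξ

lemma hasDerivWithinAt_gns {t : ℝ} (ht : t ∈ I) (a : A) (ξ : τ.GNS) :
    HasDerivWithinAt (fun s => τ.gnsStarAlgHom (E s a) ξ)
      (τ.gnsStarAlgHom (dE τ E I t a) ξ) I t := by
  rw [h.gns_dE ht]
  exact ((h.smooth a ξ).differentiableOn one_ne_zero t ht).hasDerivWithinAt

lemma hasDerivWithinAt_toL2 {t : ℝ} (ht : t ∈ I) (a : A) :
    HasDerivWithinAt (fun s => toL2 τ (E s a)) (toL2 τ (dE τ E I t a)) I t := by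
  simpa only [gns_apply_toL2_one] using h.hasDerivWithinAt_gns ht a (toL2 τ 1)

lemma dE_of_not_accPt {t : ℝ} (ht : t ∈ I) (hacc : ¬AccPt t (𝓟 I)) (a : A) : dE τ E I t a = 0 := by
  apply h.faithful.toL2_injective
  rw [← gns_apply_toL2_one, h.gns_dE ht, derivOp, derivWithin_zero_of_not_accPt hacc, toL2_zero]

lemma dE_eq {t : ℝ} (ht : t ∈ I) {a x : A} (hacc : AccPt t (𝓟 I))
    (hx : HasDerivWithinAt (fun s => toL2 τ (E s a)) (toL2 τ x) I t) : dE τ E I t a = x :=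
  h.faithful.toL2_injective <|
    (hacc.uniqueDiffWithinAt).eq_deriv I (h.hasDerivWithinAt_toL2 ht a) hx

lemma dE_add {t : ℝ} (ht : t ∈ I) (a b : A) :
    dE τ E I t (a + b) = dE τ E I t a + dE τ E I t b := by
  by_cases hacc : AccPt t (𝓟 I)
  · refine h.dE_eq ht hacc ?_
    simpa only [map_add, toL2_add] using
      (h.hasDerivWithinAt_toL2 ht a).fun_add (h.hasDerivWithinAt_toL2 ht b)
  · simp [h.dE_of_not_accPt ht hacc]

lemma dE_smul {t : ℝ} (ht : t ∈ I) (c : ℂ) (a : A) :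
    dE τ E I t (c • a) = c • dE τ E I t a := by
  by_cases hacc : AccPt t (𝓟 I)
  · refine h.dE_eq ht hacc ?_
    simpa only [map_smul, toL2_smul] using (h.hasDerivWithinAt_toL2 ht a).fun_const_smul c
  · simp [h.dE_of_not_accPt ht hacc]

/-- `dE` at a point of `I`, as a linear map. -/
lemma exists_dE_linear {t : ℝ} (ht : t ∈ I) : ∃ D : A →ₗ[ℂ] A, ∀ a, D a = dE τ E I t a :=
  ⟨{ toFun := dE τ E I t, map_add' := h.dE_add ht, map_smul' := h.dE_smul ht }, fun _ => rfl⟩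

lemma dE_star {t : ℝ} (ht : t ∈ I) (a : A) : dE τ E I t (star a) = star (dE τ E I t a) := by
  by_cases hacc : AccPt t (𝓟 I)
  · refine h.dE_eq ht hacc ?_
    exact (h.faithful.hasDerivWithinAt_star (h.hasDerivWithinAt_toL2 ht a)).congr
      (fun s hs => by rw [(h.condExp s hs).map_star]) (by rw [(h.condExp t ht).map_star])
  · simp [h.dE_of_not_accPt ht hacc]

lemma dE_one {t : ℝ} (ht : t ∈ I) : dE τ E I t 1 = 0 := by
  by_cases hacc : AccPt t (𝓟 I)
  · refine h.dE_eq ht hacc ?_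
    rw [toL2_zero]
    exact (hasDerivWithinAt_const t I (toL2 τ 1)).congr
      (fun s hs => by rw [(h.condExp s hs).map_one]) (by rw [(h.condExp t ht).map_one])
  · exact h.dE_of_not_accPt ht hacc 1

lemma dE_inner_symm {t : ℝ} (ht : t ∈ I) (a b : A) :
    ⟪toL2 τ (dE τ E I t a), toL2 τ b⟫_ℂ = ⟪toL2 τ a, toL2 τ (dE τ E I t b)⟫_ℂ := by
  by_cases hacc : AccPt t (𝓟 I)
  · have h1 := (h.hasDerivWithinAt_toL2 ht a).inner ℂ (hasDerivWithinAt_const t I (toL2 τ b))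
    have h2 := (hasDerivWithinAt_const t I (toL2 τ a)).inner ℂ (h.hasDerivWithinAt_toL2 ht b)
    have h3 := h2.congr (fun s hs => (h.condExp s hs).inner_symm a b)
      ((h.condExp t ht).inner_symm a b)
    simpa using hacc.uniqueDiffWithinAt.eq_deriv I h1 h3
  · simp [h.dE_of_not_accPt ht hacc, toL2_zero]

lemma extendL2_condExp {t : ℝ} (ht : t ∈ I) (a : A) :
    extendL2 τ (E t) (toL2 τ a) = toL2 τ (E t a) :=
  extendL2_toL2 (K := 1) (by simpa using (h.condExp t ht).norm_toL2_le) a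

lemma norm_extendL2_condExp {t : ℝ} (ht : t ∈ I) : ‖extendL2 τ (E t)‖ ≤ 1 :=
  opNorm_le_of_toL2 zero_le_one fun a => by
    rw [h.extendL2_condExp ht, one_mul]; exact (h.condExp t ht).norm_toL2_le a

lemma continuousOn_extendL2_condExp (ξ : τ.GNS) :
    ContinuousOn (fun t => extendL2 τ (E t) ξ) I :=
  continuousOn_of_toL2 h.ordConnected
    (fun _ _ hcd => ⟨1, zero_le_one, fun _ ht => h.norm_extendL2_condExp (hcd ht)⟩)
    (fun a _ ht => (h.hasDerivWithinAt_toL2 ht a).continuousWithinAt.congr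
      (fun _ hs => h.extendL2_condExp hs a) (h.extendL2_condExp ht a)) ξ

/-- Product rule for `E_t (α t)`. -/
lemma hasDerivWithinAt_toL2_condExp {α : ℝ → A} {x : A} {t : ℝ} (ht : t ∈ I)
    (hα : HasDerivWithinAt (fun s => toL2 τ (α s)) (toL2 τ x) I t) :
    HasDerivWithinAt (fun s => toL2 τ (E s (α s))) (toL2 τ (dE τ E I t (α t) + E t x)) I t := by
  have hle : 𝓝[I \ {t}] t ≤ 𝓝[I] t := nhdsWithin_mono _ sdiff_subset
  have h1 : Tendsto (fun s => extendL2 τ (E s) (slope (fun s => toL2 τ (α s)) t s)) (𝓝[I \ {t}] t)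
      (𝓝 (extendL2 τ (E t) (toL2 τ x))) :=
    tendsto_strong_apply (mem_of_superset self_mem_nhdsWithin
        fun s hs => h.norm_extendL2_condExp hs.1)
      ((h.continuousOn_extendL2_condExp _ t ht).mono_left hle)
      (hasDerivWithinAt_iff_tendsto_slope.1 hα)
  have h2 := hasDerivWithinAt_iff_tendsto_slope.1 (h.hasDerivWithinAt_toL2 ht (α t))
  rw [h.extendL2_condExp ht] at h1
  rw [hasDerivWithinAt_iff_tendsto_slope, toL2_add]
  refine (h2.add h1).congr' (mem_of_superset self_mem_nhdsWithin fun s hs => ?_)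
  simp only [slope, vsub_eq_sub, mem_ofPred_eq, ← toL2_sub, ← toL2_real_smul, ← toL2_add,
    h.extendL2_condExp hs.1]
  congr 1
  simp only [← Complex.coe_smul, map_smul, map_sub, smul_sub]
  abel

/-- The derivative of the relation `E_t² = E_t`. -/
lemma dE_condExp {t : ℝ} (ht : t ∈ I) (a : A) :
    dE τ E I t (E t a) = dE τ E I t a - E t (dE τ E I t a) := by
  by_cases hacc : AccPt t (𝓟 I)
  · rw [eq_sub_iff_add_eq]
    refine (h.dE_eq ht hacc ?_).symm
    exact (h.hasDerivWithinAt_toL2_condExp ht (h.hasDerivWithinAt_toL2 ht a)).congr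
      (fun s hs => by rw [(h.condExp s hs).idempotent]) (by rw [(h.condExp t ht).idempotent])
  · simp [h.dE_of_not_accPt ht hacc]

/-- The diagonal corner of `dE` vanishes. -/
lemma condExp_dE_condExp {t : ℝ} (ht : t ∈ I) (a : A) : E t (dE τ E I t (E t a)) = 0 := by
  rw [h.dE_condExp ht, map_sub, (h.condExp t ht).idempotent, sub_self]

lemma continuousOn_gns_dE (a : A) (ξ : τ.GNS) :
    ContinuousOn (fun t => τ.gnsStarAlgHom (dE τ E I t a) ξ) I := by
  rcases I.subsingleton_or_nontrivial with hsub | ⟨c, hc, d, hd, hcd⟩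
  · exact hsub.continuousOn _
  · have huniq : UniqueDiffOn ℝ I := by
      refine uniqueDiffOn_convex h.ordConnected.convex ?_
      have hint : (interior (uIcc c d)).Nonempty := by
        rw [uIcc, interior_Icc]; exact nonempty_Ioo.2 (min_lt_max.2 hcd)
      exact hint.mono (interior_mono (h.ordConnected.uIcc_subset hc hd))
    exact ((h.smooth a ξ).continuousOn_derivWithin huniq le_rfl).congr fun t ht => h.gns_dE ht a ξ

lemma continuousOn_toL2_dE (a : A) : ContinuousOn (fun t => toL2 τ (dE τ E I t a)) I := by
  simpa only [gns_apply_toL2_one] using h.continuousOn_gns_dE a (toL2 τ 1)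

/-- `dE` is bounded for the norm of `A`, uniformly on compact subintervals. At each point it is
bounded by the closed graph theorem, being symmetric for the inner product of `L²(A, τ)`. -/
lemma exists_norm_dE_le {c d : ℝ} (hcd : Icc c d ⊆ I) :
    ∃ K, 0 ≤ K ∧ ∀ t ∈ Icc c d, ∀ a, ‖dE τ E I t a‖ ≤ K * ‖a‖ := by
  have hex (t : Icc c d) : ∃ D : A →L[ℂ] A, ∀ a, D a = dE τ E I t a := by
    obtain ⟨D, hD⟩ := h.exists_dE_linear (hcd t.2)
    refine ⟨⟨D, D.continuous_of_seq_closed_graph fun u x y hu hDu => ?_⟩, hD⟩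
    apply h.faithful.toL2_injective
    refine denseRange_toL2.eq_of_inner_left (𝕜 := ℂ) fun b => ?_
    have h1 : Tendsto (fun n => ⟪toL2 τ (D (u n)), toL2 τ b⟫_ℂ) atTop (𝓝 ⟪toL2 τ y, toL2 τ b⟫_ℂ) :=
      ((continuous_toL2.tendsto _).comp hDu).inner tendsto_const_nhds
    have h2 : Tendsto (fun n => ⟪toL2 τ (u n), toL2 τ (D b)⟫_ℂ) atTop
        (𝓝 ⟪toL2 τ x, toL2 τ (D b)⟫_ℂ) :=
      ((continuous_toL2.tendsto _).comp hu).inner tendsto_const_nhds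
    rw [hD, h.dE_inner_symm (hcd t.2), ← hD]
    refine tendsto_nhds_unique h1 (h2.congr fun n => ?_)
    rw [hD, hD, h.dE_inner_symm (hcd t.2)]
  choose D hD using hex
  obtain ⟨K, hK⟩ := banach_steinhaus (g := D) fun a => by
    obtain ⟨C, -, hC⟩ := exists_norm_le_of_strong_continuousOn
      (X := fun t => τ.gnsStarAlgHom (dE τ E I t a)) (c := c) (d := d)
      fun ξ => (h.continuousOn_gns_dE a ξ).mono hcd
    exact ⟨C, fun t => by rw [hD, ← h.faithful.norm_gns]; exact hC t t.2⟩
  refine ⟨max K 0, le_max_right _ _, fun t ht a => ?_⟩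
  rw [← hD ⟨t, ht⟩]
  exact (D ⟨t, ht⟩).le_of_opNorm_le ((hK _).trans (le_max_left _ _)) a

/-- `dE` is bounded for the `L²` norm by its bound for the norm of `A`. -/
lemma norm_toL2_dE_le {t : ℝ} (ht : t ∈ I) {K : ℝ} (hK0 : 0 ≤ K)
    (hK : ∀ a, ‖dE τ E I t a‖ ≤ K * ‖a‖) (a : A) :
    ‖toL2 τ (dE τ E I t a)‖ ≤ K * ‖toL2 τ a‖ := by
  obtain ⟨D, hD⟩ := h.exists_dE_linear ht
  rw [← hD]
  refine norm_toL2_apply_le_of_symmetric hK0 (fun a => ?_) (fun a b => ?_) a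
  · rw [hD]; exact hK a
  · rw [hD, hD]; exact h.dE_inner_symm ht a b

end IsSmoothExpectationPath

end CondExp

/-! ### The transport equation and its propagators -/

section Transport

open Filter Topology

variable {A : Type*} [CStarAlgebra A] [PartialOrder A] [StarOrderedRing A] {τ : A →ₚ[ℂ] ℂ}

/-- The curve `α` in `A` solves the transport equation on `I`, with derivative in the norm of
`L²(A, τ)`. -/
def IsStrongTransportSolution (τ : A →ₚ[ℂ] ℂ) (E : ℝ → A →ₗ[ℂ] A) (I : Set ℝ) (α : ℝ → A) : Prop :=
  ∀ t ∈ I, HasDerivWithinAt (fun u => toL2 τ (α u)) (toL2 τ (transportGen τ E I t (α t))) I t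

/-- Strong solutions are weak solutions. -/
lemma IsStrongTransportSolution.isTransportSolution {E : ℝ → A →ₗ[ℂ] A} {I : Set ℝ} {α : ℝ → A}
    (hα : IsStrongTransportSolution τ E I α) (s : ℝ) : IsTransportSolution τ E I s (α s) α :=
  ⟨rfl, fun ξ t ht => by simpa using (hasDerivWithinAt_const t I ξ).inner ℂ (hα t ht)⟩

namespace IsSmoothExpectationPath

variable {I : Set ℝ} {B : ℝ → StarSubalgebra ℂ A} {E : ℝ → A →ₗ[ℂ] A}
  (h : IsSmoothExpectationPath τ I B E)
include h

lemma transportGen_eq {t : ℝ} (ht : t ∈ I) (a : A) :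
    transportGen τ E I t a = dE τ E I t a - (2 : ℂ) • E t (dE τ E I t a) := by
  rw [transportGen, h.dE_condExp ht, two_smul]; abel

lemma transportGen_add {t : ℝ} (ht : t ∈ I) (a b : A) :
    transportGen τ E I t (a + b) = transportGen τ E I t a + transportGen τ E I t b := by
  simp only [transportGen, map_add, h.dE_add ht]; abel

lemma transportGen_smul {t : ℝ} (ht : t ∈ I) (c : ℂ) (a : A) :
    transportGen τ E I t (c • a) = c • transportGen τ E I t a := by
  simp only [transportGen, map_smul, h.dE_smul ht, smul_sub]

lemma transportGen_star {t : ℝ} (ht : t ∈ I) (a : A) :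
    transportGen τ E I t (star a) = star (transportGen τ E I t a) := by
  simp only [transportGen, (h.condExp t ht).map_star, h.dE_star ht, star_sub]

lemma transportGen_one {t : ℝ} (ht : t ∈ I) : transportGen τ E I t 1 = 0 := by
  simp [transportGen_eq h ht, h.dE_one ht]

/-- The commutator of the generator `[dE_t, E_t]` with `E_t` is `dE_t`: both sides are the
off-diagonal part of `dE_t`. This is the infinitesimal form of the intertwining relation. -/
lemma transportGen_condExp {t : ℝ} (ht : t ∈ I) (a : A) :
    transportGen τ E I t (E t a) = dE τ E I t a + E t (transportGen τ E I t a) := by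
  have hidem := (h.condExp t ht).idempotent
  rw [transportGen, hidem, h.condExp_dE_condExp ht, transportGen, map_sub,
    h.condExp_dE_condExp ht, hidem, h.dE_condExp ht]
  abel

lemma transportGen_inner_skew {t : ℝ} (ht : t ∈ I) (a b : A) :
    ⟪toL2 τ (transportGen τ E I t a), toL2 τ b⟫_ℂ
      = -⟪toL2 τ a, toL2 τ (transportGen τ E I t b)⟫_ℂ := by
  simp only [transportGen, toL2_sub, inner_sub_left, inner_sub_right, h.dE_inner_symm ht,
    (h.condExp t ht).inner_symm]
  ring

lemma norm_transportGen_le {t : ℝ} (ht : t ∈ I) {K : ℝ}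
    (hK : ∀ a, ‖dE τ E I t a‖ ≤ K * ‖a‖) (a : A) :
    ‖transportGen τ E I t a‖ ≤ 3 * K * ‖a‖ := by
  rw [h.transportGen_eq ht]
  refine (norm_sub_le _ _).trans ?_
  rw [norm_smul, Complex.norm_ofNat]
  linarith [hK a, (h.condExp t ht).norm_le (dE τ E I t a)]

lemma norm_toL2_transportGen_le {t : ℝ} (ht : t ∈ I) {K : ℝ} (hK0 : 0 ≤ K)
    (hK : ∀ a, ‖dE τ E I t a‖ ≤ K * ‖a‖) (a : A) :
    ‖toL2 τ (transportGen τ E I t a)‖ ≤ 3 * K * ‖toL2 τ a‖ := by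
  rw [h.transportGen_eq ht, toL2_sub, toL2_smul]
  refine (norm_sub_le _ _).trans ?_
  rw [norm_smul, Complex.norm_ofNat]
  linarith [h.norm_toL2_dE_le ht hK0 hK a, (h.condExp t ht).norm_toL2_le (dE τ E I t a)]

/-- The generator of the transport equation extends to a strongly continuous family of bounded
skew-adjoint operators on `L²(A, τ)`, which is also bounded for the norm of `A`, here in the form of
the gauge given by `unitBallPolar`. -/
lemma exists_generator : ∃ X : ℝ → τ.GNS →L[ℂ] τ.GNS,
    (∀ t ∈ I, ∀ a, X t (toL2 τ a) = toL2 τ (transportGen τ E I t a)) ∧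
    (∀ ξ, ContinuousOn (fun t => X t ξ) I) ∧
    (∀ t ∈ I, ∀ ξ η, ⟪X t ξ, η⟫_ℂ = -⟪ξ, X t η⟫_ℂ) ∧
    ∀ c d, Icc c d ⊆ I → ∃ K, 0 ≤ K ∧ ∀ t ∈ Icc c d, ∀ r, 0 ≤ r → ∀ x,
      (∀ φ ∈ unitBallPolar τ, |φ x| ≤ r) → ∀ φ ∈ unitBallPolar τ, |φ (X t x)| ≤ K * r := by
  have hex (t : ℝ) : ∃ X : τ.GNS →L[ℂ] τ.GNS,
      t ∈ I → ∀ a, X (toL2 τ a) = toL2 τ (transportGen τ E I t a) := by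
    by_cases ht : t ∈ I
    · obtain ⟨K, hK0, hK⟩ := h.exists_norm_dE_le (c := t) (d := t) (by simpa using ht)
      let F : A →ₗ[ℂ] A :=
        { toFun := transportGen τ E I t
          map_add' := h.transportGen_add ht
          map_smul' := h.transportGen_smul ht }
      exact ⟨extendL2 τ F, fun _ => extendL2_toL2 (F := F)
        (h.norm_toL2_transportGen_le ht hK0 (hK t ⟨le_rfl, le_rfl⟩))⟩
    · exact ⟨0, fun h => absurd h ht⟩
  choose X hX using hex
  refine ⟨X, hX, fun ξ => continuousOn_of_toL2 h.ordConnected (fun c d hcd => ?_) (fun a => ?_) ξ,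
    fun t ht ξ η => ?_, fun c d hcd => ?_⟩
  · obtain ⟨K, hK0, hK⟩ := h.exists_norm_dE_le hcd
    refine ⟨3 * K, by positivity, fun t ht => opNorm_le_of_toL2 (by positivity) fun a => ?_⟩
    rw [hX t (hcd ht)]
    exact h.norm_toL2_transportGen_le (hcd ht) hK0 (hK t ht) a
  · have h1 := h.continuousOn_toL2_dE a
    have h2 := continuousOn_strong_apply h.ordConnected h.continuousOn_extendL2_condExp h1
    refine (h1.sub (h2.const_smul (2 : ℂ))).congr fun t ht => ?_
    simp only [hX t ht, h.transportGen_eq ht, toL2_sub, toL2_smul, ← h.extendL2_condExp ht]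
    rfl
  · refine denseRange_toL2.induction_on₂ (p := fun ξ η => ⟪X t ξ, η⟫_ℂ = -⟪ξ, X t η⟫_ℂ)
      (isClosed_eq (by fun_prop) (by fun_prop)) (fun a b => ?_) ξ η
    rw [hX t ht, hX t ht]
    exact h.transportGen_inner_skew ht a b
  · obtain ⟨K, hK0, hK⟩ := h.exists_norm_dE_le hcd
    refine ⟨3 * K, by positivity, fun t ht r hr x hx φ hφ => ?_⟩
    have hcont : Tendsto (fun r' : ℝ => 3 * K * r') (𝓝[>] r) (𝓝 (3 * K * r)) :=
      (continuous_const.mul continuous_id).continuousWithinAt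
    refine ge_of_tendsto hcont (eventually_mem_nhdsWithin.mono fun r' hr' => ?_)
    obtain ⟨a, ha, rfl⟩ := exists_toL2_eq_of_polar h.faithful h.vonNeumann (hr.trans_lt hr')
      fun φ hφ => (hx φ hφ).trans (le_of_lt hr')
    rw [hX t (hcd ht)]
    refine (abs_apply_toL2_le hφ _).trans ((h.norm_transportGen_le (hcd ht) (hK t ht) a).trans ?_)
    gcongr

/-- Existence for the transport equation: by the bipolar theorem for the unit ball of `A`, the
solution of the extended equation in `L²(A, τ)` stays in `A` when it starts there. -/
lemma exists_strong_solution {s : ℝ} (hs : s ∈ I) (a : A) : ∃ α : ℝ → A, α s = a ∧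
    IsStrongTransportSolution τ E I α ∧
    ∀ c d : ℝ, Icc c d ⊆ I → ∃ K : ℝ, ∀ t ∈ Icc c d, ‖α t‖ ≤ K := by
  obtain ⟨X, hX, hXc, -, hP⟩ := h.exists_generator
  obtain ⟨γ, hγs, hγ, hγb⟩ := exists_linear_ode_solution h.ordConnected
    (X := fun t => (X t).restrictScalars ℝ) hXc hP hs (toL2 τ a)
  have hb {c d : ℝ} (hcd : Icc c d ⊆ I) (hsc : s ∈ Icc c d) :
      ∃ K, ∀ t ∈ Icc c d, ∃ b, ‖b‖ ≤ K ∧ toL2 τ b = γ t := by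
    obtain ⟨C, hC0, hC⟩ := hγb c d hcd hsc
    refine ⟨C * ‖a‖ + 1, fun t ht => exists_toL2_eq_of_polar h.faithful h.vonNeumann
      (by positivity) fun φ hφ => ?_⟩
    exact (hC _ (norm_nonneg a) (fun φ hφ => abs_apply_toL2_le hφ a) t ht φ hφ).trans (by simp)
  have hex (t : ℝ) : ∃ b : A, t ∈ I → toL2 τ b = γ t := by
    by_cases ht : t ∈ I
    · obtain ⟨c, d, hsc, htc, hcd, -⟩ := exists_Icc_mem_nhdsWithin h.ordConnected hs ht
      obtain ⟨K, hK⟩ := hb hcd hsc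
      obtain ⟨b, -, hbt⟩ := hK t htc
      exact ⟨b, fun _ => hbt⟩
    · exact ⟨0, fun h => absurd h ht⟩
  choose α hα using hex
  refine ⟨α, h.faithful.toL2_injective ((hα s hs).trans hγs), fun t ht => ?_, fun c d hcd => ?_⟩
  · rw [← hX t ht, hα t ht]
    exact (hγ t ht).congr hα (hα t ht)
  · rcases lt_or_ge d c with hdc | hdc
    · exact ⟨0, by simp [Icc_eq_empty_of_lt hdc]⟩
    have hc : min c s ∈ I := by
      rcases min_choice c s with h | h <;> rw [h]
      exacts [hcd ⟨le_rfl, hdc⟩, hs]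
    have hd : max d s ∈ I := by
      rcases max_choice d s with h | h <;> rw [h]
      exacts [hcd ⟨hdc, le_rfl⟩, hs]
    obtain ⟨K, hK⟩ := hb (h.ordConnected.out hc hd) ⟨min_le_right _ _, le_max_right _ _⟩
    refine ⟨K, fun t ht => ?_⟩
    obtain ⟨b, hbK, hbt⟩ := hK t ⟨(min_le_left _ _).trans ht.1, ht.2.trans (le_max_left _ _)⟩
    rwa [h.faithful.toL2_injective ((hα t (hcd ht)).trans hbt.symm)]

/-- Uniqueness for the transport equation. -/
lemma eqOn_of_isTransportSolution {s : ℝ} (hs : s ∈ I) {a : A} {α β : ℝ → A}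
    (hα : IsTransportSolution τ E I s a α) (hβ : IsTransportSolution τ E I s a β) :
    EqOn α β I := by
  obtain ⟨X, hX, hXc, hskew, -⟩ := h.exists_generator
  intro t ht
  apply h.faithful.toL2_injective
  rw [← sub_eq_zero]
  refine eq_zero_of_weak_solution h.ordConnected hXc hskew
    (β := fun t => toL2 τ (α t) - toL2 τ (β t)) (fun ξ t ht => ?_) hs ht
    (by rw [hα.1, hβ.1, sub_self])
  simpa only [map_sub, inner_sub_right, hX t ht] using (hα.2 ξ t ht).fun_sub (hβ.2 ξ t ht)

lemma isTransportSolution_propagator {s : ℝ} (hs : s ∈ I) (a : A) :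
    IsTransportSolution τ E I s a (fun t => propagator τ E I t s a) := by
  obtain ⟨α, hαs, hα, -⟩ := h.exists_strong_solution hs a
  have hex : ∃ α : ℝ → A, IsTransportSolution τ E I s a α :=
    ⟨α, hαs ▸ hα.isTransportSolution s⟩
  simp only [propagator, dif_pos hex]
  exact hex.choose_spec

lemma propagator_apply {s t : ℝ} (hs : s ∈ I) (ht : t ∈ I) {α : ℝ → A}
    (hα : IsStrongTransportSolution τ E I α) : propagator τ E I t s (α s) = α t :=
  h.eqOn_of_isTransportSolution hs (h.isTransportSolution_propagator hs (α s))
    (hα.isTransportSolution s) ht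

lemma propagator_self {s : ℝ} (hs : s ∈ I) (a : A) : propagator τ E I s s a = a :=
  (h.isTransportSolution_propagator hs a).1

lemma isStrongTransportSolution_propagator {s : ℝ} (hs : s ∈ I) (a : A) :
    IsStrongTransportSolution τ E I (fun t => propagator τ E I t s a) := by
  obtain ⟨α, rfl, hα, -⟩ := h.exists_strong_solution hs a
  intro t ht
  beta_reduce
  rw [h.propagator_apply hs ht hα]
  exact (hα t ht).congr (fun u hu => by rw [h.propagator_apply hs hu hα])
    (by rw [h.propagator_apply hs ht hα])

lemma propagator_propagator {s t : ℝ} (hs : s ∈ I) (ht : t ∈ I) (a : A) :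
    propagator τ E I s t (propagator τ E I t s a) = a := by
  rw [h.propagator_apply ht hs (h.isStrongTransportSolution_propagator hs a), h.propagator_self hs]

lemma propagator_add {s t : ℝ} (hs : s ∈ I) (ht : t ∈ I) (a b : A) :
    propagator τ E I t s (a + b) = propagator τ E I t s a + propagator τ E I t s b := by
  have hsol : IsStrongTransportSolution τ E I
      (fun u => propagator τ E I u s a + propagator τ E I u s b) := fun u hu => by
    simpa only [toL2_add, h.transportGen_add hu] using
      (h.isStrongTransportSolution_propagator hs a u hu).fun_add
        (h.isStrongTransportSolution_propagator hs b u hu)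
  simpa only [h.propagator_self hs] using h.propagator_apply hs ht hsol

lemma propagator_smul {s t : ℝ} (hs : s ∈ I) (ht : t ∈ I) (c : ℂ) (a : A) :
    propagator τ E I t s (c • a) = c • propagator τ E I t s a := by
  have hsol : IsStrongTransportSolution τ E I (fun u => c • propagator τ E I u s a) :=
    fun u hu => by
      simpa only [toL2_smul, h.transportGen_smul hu] using
        (h.isStrongTransportSolution_propagator hs a u hu).fun_const_smul c
  simpa only [h.propagator_self hs] using h.propagator_apply hs ht hsol

lemma propagator_star {s t : ℝ} (hs : s ∈ I) (ht : t ∈ I) (a : A) :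
    propagator τ E I t s (star a) = star (propagator τ E I t s a) := by
  have hsol : IsStrongTransportSolution τ E I (fun u => star (propagator τ E I u s a)) :=
    fun u hu => by
      simpa only [h.transportGen_star hu] using
        h.faithful.hasDerivWithinAt_star (h.isStrongTransportSolution_propagator hs a u hu)
  simpa only [h.propagator_self hs] using h.propagator_apply hs ht hsol

lemma propagator_one {s t : ℝ} (hs : s ∈ I) (ht : t ∈ I) : propagator τ E I t s 1 = 1 := by
  have hsol : IsStrongTransportSolution τ E I (fun _ => 1) := fun u hu => by
    simpa only [h.transportGen_one hu, toL2_zero] using hasDerivWithinAt_const u I (toL2 τ 1)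
  exact h.propagator_apply hs ht hsol

/-- The conditional expectations are transported along the propagators. -/
lemma propagator_condExp {s t : ℝ} (hs : s ∈ I) (ht : t ∈ I) (a : A) :
    propagator τ E I t s (E s a) = E t (propagator τ E I t s a) := by
  have hsol : IsStrongTransportSolution τ E I (fun u => E u (propagator τ E I u s a)) :=
    fun u hu => by
      rw [h.transportGen_condExp hu]
      exact h.hasDerivWithinAt_toL2_condExp hu (h.isStrongTransportSolution_propagator hs a u hu)
  simpa only [h.propagator_self hs] using h.propagator_apply hs ht hsol

/-- The propagators are isometric for the `L²` norm, the generator being skew-adjoint. -/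
lemma norm_toL2_propagator {s t : ℝ} (hs : s ∈ I) (ht : t ∈ I) (a : A) :
    ‖toL2 τ (propagator τ E I t s a)‖ = ‖toL2 τ a‖ := by
  obtain ⟨X, hX, -, hskew, -⟩ := h.exists_generator
  have hsol := h.isStrongTransportSolution_propagator hs a
  have h1 := inner_eq_of_weak_solution h.ordConnected hskew
    (β := fun u => toL2 τ (propagator τ E I u s a)) (γ := fun u => toL2 τ (propagator τ E I u s a))
    (fun ξ u hu => by
      rw [hX u hu]; exact (hsol.isTransportSolution s).2 ξ u hu)
    (fun u hu => by rw [hX u hu]; exact hsol u hu) hs ht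
  rw [h.propagator_self hs, inner_self_eq_norm_sq_to_K, inner_self_eq_norm_sq_to_K] at h1
  rw [← sq_eq_sq₀ (norm_nonneg _) (norm_nonneg _)]
  exact_mod_cast h1

lemma contDiffOn_inner_of_strong {α : ℝ → A} (hα : IsStrongTransportSolution τ E I α) (ξ : τ.GNS) :
    ContDiffOn ℝ 1 (fun t => ⟪ξ, toL2 τ (α t)⟫_ℂ) I := by
  obtain ⟨X, hX, hXc, -⟩ := h.exists_generator
  refine contDiffOn_one_of_hasDerivWithinAt ((hα.isTransportSolution 0).2 ξ) ?_
  have h1 := continuousOn_strong_apply h.ordConnected hXc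
    fun t ht => (hα t ht).continuousWithinAt
  have h2 : ContinuousOn (fun t => ⟪ξ, X t (toL2 τ (α t))⟫_ℂ) I := continuousOn_const.inner h1
  exact h2.congr fun t ht => by beta_reduce; rw [hX t ht]

/-- The propagator as a linear bijection of `A`. -/
lemma exists_linearEquiv_propagator {s t : ℝ} (hs : s ∈ I) (ht : t ∈ I) : ∃ G : A ≃ₗ[ℂ] A,
    (∀ a, G a = propagator τ E I t s a) ∧ ∀ a, G.symm a = propagator τ E I s t a :=
  ⟨{ toFun := propagator τ E I t s
     invFun := propagator τ E I s t
     map_add' := h.propagator_add hs ht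
     map_smul' := h.propagator_smul hs ht
     left_inv := h.propagator_propagator hs ht
     right_inv := h.propagator_propagator ht hs }, fun _ => rfl, fun _ => rfl⟩

lemma isStarProjection_extendL2_condExp {t : ℝ} (ht : t ∈ I) :
    IsStarProjection (extendL2 τ (E t)) := by
  refine ⟨?_, ?_⟩
  · ext ξ
    refine denseRange_toL2.induction_on ξ (isClosed_eq (by fun_prop) (by fun_prop)) fun a => ?_
    rw [mul_apply_eq_comp, h.extendL2_condExp ht, h.extendL2_condExp ht,
      (h.condExp t ht).idempotent]
  · rw [ContinuousLinearMap.isSelfAdjoint_iff_isSymmetric]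
    intro ξ η
    refine denseRange_toL2.induction_on₂
      (p := fun ξ η => ⟪extendL2 τ (E t) ξ, η⟫_ℂ = ⟪ξ, extendL2 τ (E t) η⟫_ℂ)
      (isClosed_eq (by fun_prop) (by fun_prop)) (fun a b => ?_) ξ η
    rw [h.extendL2_condExp ht, h.extendL2_condExp ht]
    exact (h.condExp t ht).inner_symm a b

end IsSmoothExpectationPath

/-- A linear bijection of `A` that preserves the `L²` norm extends to a unitary on `L²(A, τ)`. -/
lemma exists_unitary_extendsToL2 (G : A ≃ₗ[ℂ] A) (hG : ∀ a, ‖toL2 τ (G a)‖ = ‖toL2 τ a‖) :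
    ∃ U : unitary (τ.GNS →L[ℂ] τ.GNS), ExtendsToL2 τ G U := by
  have hG' (a) : ‖toL2 τ (G.symm a)‖ = ‖toL2 τ a‖ := by
    rw [← hG (G.symm a), G.apply_symm_apply]
  obtain ⟨U, hU⟩ : ∃ U : τ.GNS →L[ℂ] τ.GNS, ∀ a, U (toL2 τ a) = toL2 τ (G a) :=
    ⟨_, extendL2_toL2 (F := G.toLinearMap) (K := 1) fun a => by
      rw [one_mul]; exact (hG a).le⟩
  obtain ⟨V, hV⟩ : ∃ V : τ.GNS →L[ℂ] τ.GNS, ∀ a, V (toL2 τ a) = toL2 τ (G.symm a) :=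
    ⟨_, extendL2_toL2 (F := G.symm.toLinearMap) (K := 1) fun a => by
      rw [one_mul]; exact (hG' a).le⟩
  have hUV : U * V = 1 := by
    ext ξ
    refine denseRange_toL2.induction_on ξ (isClosed_eq (by fun_prop) (by fun_prop)) fun a => ?_
    simp [hU, hV]
  have hiso : star U * U = 1 := by
    refine U.norm_map_iff_adjoint_comp_self.1 fun ξ => ?_
    exact denseRange_toL2.induction_on ξ (isClosed_eq (by fun_prop) (by fun_prop))
      fun a => by rw [hU, hG]
  -- The isometry `U` has the right inverse `V`, which is thus its adjoint.
  have hstar : star U = V := left_inv_eq_right_inv hiso hUV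
  exact ⟨⟨U, Unitary.mem_iff.2 ⟨hiso, by rw [hstar, hUV]⟩⟩, hU⟩

end Transport

end SmoothExpectations

theorem mainTheorem1 {A : Type*} [CStarAlgebra A] [PartialOrder A] [StarOrderedRing A]
    (τ : A →ₚ[ℂ] ℂ) (hτ : SmoothExpectations.IsFaithfulTrace τ)
    (hA : SmoothExpectations.IsVonNeumannOnL2 τ ⊤)
    (I : Set ℝ) (hI : I.OrdConnected) (h0 : (0 : ℝ) ∈ I)
    (B : ℝ → StarSubalgebra ℂ A)
    (hB : ∀ t ∈ I, SmoothExpectations.IsVonNeumannOnL2 τ (B t))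
    (E : ℝ → A →ₗ[ℂ] A)
    (hE : ∀ t ∈ I, SmoothExpectations.IsTraceCondExp τ (B t) (E t))
    (hsmooth : SmoothExpectations.IsSmoothPath τ E I)
    (hint : SmoothExpectations.SquareIntegrableDeriv τ E I) :
    -- the derivative `dE_t(a)` is an element of `A`
    (∀ t ∈ I, ∀ (a : A) (ξ : τ.GNS),
      HasDerivWithinAt (fun s => τ.gnsStarAlgHom (E s a) ξ)
        (τ.gnsStarAlgHom (SmoothExpectations.dE τ E I t a) ξ) I t) ∧
    -- the transport equation is well posed, so that the propagators are defined
    (∀ s ∈ I, ∀ a : A, ∃ α : ℝ → A,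
      SmoothExpectations.IsTransportSolution τ E I s a α ∧
      (∀ c d : ℝ, Icc c d ⊆ I → ∃ K : ℝ, ∀ t ∈ Icc c d, ‖α t‖ ≤ K) ∧
      (∀ ξ : τ.GNS, ContDiffOn ℝ 1 (fun t => ⟪ξ, SmoothExpectations.toL2 τ (α t)⟫_ℂ) I) ∧
      ∀ β : ℝ → A, SmoothExpectations.IsTransportSolution τ E I s a β → EqOn β α I) ∧
    ∃ (G : ℝ → A ≃ₗ[ℂ] A) (U : ℝ → unitary (τ.GNS →L[ℂ] τ.GNS)) (e : ℝ → τ.GNS →L[ℂ] τ.GNS),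
      -- `G t` is the propagator `G_{t,0}`, a linear bijection of `A` with inverse `G_{0,t}`
      (∀ t ∈ I, ∀ a : A, G t a = SmoothExpectations.propagator τ E I t 0 a) ∧
      (∀ t ∈ I, ∀ a : A, (G t).symm a = SmoothExpectations.propagator τ E I 0 t a) ∧
      -- weakly continuously differentiable, starting at the identity
      (∀ (a : A) (ξ : τ.GNS),
        ContDiffOn ℝ 1 (fun t => ⟪ξ, SmoothExpectations.toL2 τ (G t a)⟫_ℂ) I) ∧
      (∀ a : A, G 0 a = a) ∧
      -- unital and `*`-preserving
      (∀ t ∈ I, G t 1 = 1) ∧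
      (∀ t ∈ I, ∀ a : A, G t (star a) = star (G t a)) ∧
      -- intertwining
      (∀ t ∈ I, ∀ a : A, G t (E 0 ((G t).symm a)) = E t a) ∧
      -- isometric for the `L²` norm, with unitary extensions intertwining the projections `e t`
      (∀ t ∈ I, ∀ a : A,
        ‖SmoothExpectations.toL2 τ (G t a)‖ = ‖SmoothExpectations.toL2 τ a‖) ∧
      (∀ t ∈ I, SmoothExpectations.ExtendsToL2 τ (G t) (U t)) ∧
      (∀ t ∈ I, SmoothExpectations.ExtendsToL2 τ (E t) (e t)) ∧
      (∀ t ∈ I, IsStarProjection (e t)) ∧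
      (∀ t ∈ I, (U t : τ.GNS →L[ℂ] τ.GNS) * e 0 * star (U t : τ.GNS →L[ℂ] τ.GNS) = e t) := by
  have h : SmoothExpectations.IsSmoothExpectationPath τ I B E := ⟨hτ, hA, hI, hE, hsmooth⟩
  refine ⟨fun t ht a ξ => h.hasDerivWithinAt_gns ht a ξ, fun s hs a => ?_, ?_⟩
  · obtain ⟨α, rfl, hα, hb⟩ := h.exists_strong_solution hs a
    exact ⟨α, hα.isTransportSolution s, hb, h.contDiffOn_inner_of_strong hα,
      fun β hβ => h.eqOn_of_isTransportSolution hs hβ (hα.isTransportSolution s)⟩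
  have hex (t : ℝ) : ∃ G : A ≃ₗ[ℂ] A, t ∈ I →
      (∀ a, G a = SmoothExpectations.propagator τ E I t 0 a) ∧
        ∀ a, G.symm a = SmoothExpectations.propagator τ E I 0 t a := by
    by_cases ht : t ∈ I
    · obtain ⟨G, hG⟩ := h.exists_linearEquiv_propagator h0 ht
      exact ⟨G, fun _ => hG⟩
    · exact ⟨.refl ℂ A, fun h => absurd h ht⟩
  choose G hG using hex
  have hnorm : ∀ t ∈ I, ∀ a,
      ‖SmoothExpectations.toL2 τ (G t a)‖ = ‖SmoothExpectations.toL2 τ a‖ := fun t ht a => by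
    rw [(hG t ht).1, h.norm_toL2_propagator h0 ht]
  have hexU (t : ℝ) : ∃ U : unitary (τ.GNS →L[ℂ] τ.GNS),
      t ∈ I → SmoothExpectations.ExtendsToL2 τ (G t) U := by
    by_cases ht : t ∈ I
    · obtain ⟨U, hU⟩ := SmoothExpectations.exists_unitary_extendsToL2 (G t) (hnorm t ht)
      exact ⟨U, fun _ => hU⟩
    · exact ⟨1, fun h => absurd h ht⟩
  choose U hU using hexU
  have hGE : ∀ t ∈ I, ∀ a, G t (E 0 a) = E t (G t a) := fun t ht a => by
    rw [(hG t ht).1, (hG t ht).1, h.propagator_condExp h0 ht]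
  refine ⟨G, U, fun t => SmoothExpectations.extendL2 τ (E t), fun t ht => (hG t ht).1,
    fun t ht => (hG t ht).2, fun a ξ => ?_, fun a => ?_, fun t ht => ?_, fun t ht a => ?_,
    fun t ht a => ?_, hnorm, hU, fun t ht => h.extendL2_condExp ht,
    fun t ht => h.isStarProjection_extendL2_condExp ht, fun t ht => ?_⟩
  · exact (h.contDiffOn_inner_of_strong (h.isStrongTransportSolution_propagator h0 a) ξ).congr
      fun t ht => by rw [(hG t ht).1]
  · rw [(hG 0 h0).1, h.propagator_self h0]
  · rw [(hG t ht).1, h.propagator_one h0 ht]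
  · rw [(hG t ht).1, (hG t ht).1, h.propagator_star h0 ht]
  · rw [hGE t ht, LinearEquiv.apply_symm_apply]
  · have hcomm : (U t : τ.GNS →L[ℂ] τ.GNS) * SmoothExpectations.extendL2 τ (E 0)
        = SmoothExpectations.extendL2 τ (E t) * U t := by
      ext ξ
      refine SmoothExpectations.denseRange_toL2.induction_on ξ
        (isClosed_eq (by fun_prop) (by fun_prop)) fun a => ?_
      simp only [mul_apply_eq_comp]
      rw [h.extendL2_condExp h0, hU t ht, hU t ht, h.extendL2_condExp ht, hGE t ht]
    rw [hcomm, mul_assoc, Unitary.mul_star_self_of_mem (U t).2, mul_one]
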